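/- Let $\mathbb G=(\mathbb R^n,\cdot)$ be a stratified Lie group (homogeneous Carnot group): a Lie group with neutral element $0$, with a decomposition $\mathbb R^n=\mathbb R^{n_1}\times\cdots\times\mathbb R^{n_k}$ for which the dilations $T_\delta(x)=(\delta x^{(1)},\delta^2x^{(2)},\dots,\delta^kx^{(k)})$, $\delta>0$, are group automorphisms, and such that the left invariant vector fields $X_1,\dots,X_{n_1}$ with $X_j(0)=\partial/\partial x_j|_0$ satisfy Hörmander's rank condition at every point. Let $Q=\sum_{i=1}^k i\,n_i$ be its homogeneous dimension, $dx$ Lebesgue measure, $\nabla_{\mathbb G}v=(X_1v,\dots,X_{n_1}v)$ the (weak) horizontal gradient, and let $|\cdot|$ be a homogeneous norm on $\mathbb G$, i.e. a continuous function $\mathbb G\to[0,\infty)$ with $|x|=0$ only for $x=0$, $|x^{-1}|=|x|$ and $|T_\delta x|=\delta|x|$ for $\delta>0$. Let $\Omega\subset\mathbb G$ be a bounded domain, and for $1<p<\infty$ let $W_0^{1,p}(\Omega)$ be the closure of $C_c^\infty(\Omega)$ in the norm $\|v\|_{L^p(\Omega)}+\|\nabla_{\mathbb G}v\|_{L^p(\Omega)}$.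 **Theorem 2.4.** For every $s\in(0,1)$ there are constants $C_p=C_p(Q,s,\Omega)$, $p\in(1,\infty)$, and $C=C(Q,s,\Omega)\in(0,\infty)$ with $C_p\to C$ as $p\to\infty$ such that, for every $p\in(1,\infty)$ and every $v\in W_0^{1,p}(\Omega)$, with $\bar v$ denoting the extension of $v$ by $0$ outside $\Omega$, $$\left(\iint_{\Omega\times\Omega}\frac{|\bar v(x)-\bar v(y)|^p}{|y^{-1}\cdot x|^{Q+ps}}\,dx\,dy\right)^{1/p}\le C_p\,\|\nabla_{\mathbb G}v\|_{L^p(\Omega)},$$ and the same inequality holds with $\Omega\times\Omega$ replaced by $\mathbb G\times\mathbb G$. (The constants may depend on the group, of which $\Omega$ is a subset, and on the fixed homogeneous norm.) -/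

import Mathlib

open MeasureTheory Filter Topology
open scoped ContDiff ENNReal

/-- A Lie group on `ℝⁿ` with neutral element `0`, together with a decomposition
`ℝⁿ = ℝ^{n₁} × ⋯ × ℝ^{n_k}` for which the maps `x ↦ (δ x⁽¹⁾, δ² x⁽²⁾, …, δᵏ x⁽ᵏ⁾)`, `δ > 0`, are
group automorphisms.  The decomposition is recorded by the nondecreasing function `deg`: the
coordinate `x_j` belongs to the block number `deg j`, and `n_i` is the number of `j` with
`deg j = i`. -/
structure GradedGroup (n : ℕ) where
  mul : (Fin n → ℝ) → (Fin n → ℝ) → (Fin n → ℝ)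
  inv : (Fin n → ℝ) → (Fin n → ℝ)
  deg : Fin n → ℕ
  mul_assoc : ∀ x y z, mul (mul x y) z = mul x (mul y z)
  zero_mul : ∀ x, mul 0 x = x
  mul_zero : ∀ x, mul x 0 = x
  inv_mul : ∀ x, mul (inv x) x = 0
  mul_inv : ∀ x, mul x (inv x) = 0
  contDiff_mul : ContDiff ℝ ∞ (fun z : (Fin n → ℝ) × (Fin n → ℝ) => mul z.1 z.2)
  contDiff_inv : ContDiff ℝ ∞ inv
  one_le_deg : ∀ j, 1 ≤ deg j
  monotone_deg : Monotone deg
  dilation_mul : ∀ δ : ℝ, 0 < δ → ∀ x y : Fin n → ℝ,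
    (fun j => δ ^ deg j * mul x y j) =
      mul (fun j => δ ^ deg j * x j) (fun j => δ ^ deg j * y j)

namespace GradedGroup

variable {n : ℕ} (G : GradedGroup n)

/-- The dilation `T_δ`. -/
def dilation (δ : ℝ) (x : Fin n → ℝ) : Fin n → ℝ := fun j => δ ^ G.deg j * x j

/-- The homogeneous dimension `Q = ∑ i nᵢ`. -/
def homDim : ℕ := ∑ j, G.deg j

/-- The indices `j` of the coordinates of the first layer `ℝ^{n₁}`. -/
abbrev Horizontal : Type := {j : Fin n // G.deg j = 1}

/-- The left invariant vector field `X_j` on `ℝⁿ` with `X_j(0) = ∂/∂x_j`. -/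
noncomputable def X (j : G.Horizontal) (x : Fin n → ℝ) : Fin n → ℝ :=
  fderiv ℝ (G.mul x) 0 (Pi.single j.1 1)

/-- The iterated commutators of the vector fields `X_j`, `j` in the first layer. -/
inductive IsIteratedCommutator : ((Fin n → ℝ) → (Fin n → ℝ)) → Prop
  | base (j : G.Horizontal) : IsIteratedCommutator (G.X j)
  | bracket (V W : (Fin n → ℝ) → (Fin n → ℝ)) :
      IsIteratedCommutator V → IsIteratedCommutator W →
      IsIteratedCommutator (VectorField.lieBracket ℝ V W)

/-- The horizontal gradient `∇_𝔾 φ = (X_1 φ, …, X_{n₁} φ)` of a differentiable function. -/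
noncomputable def hgrad (φ : (Fin n → ℝ) → ℝ) (x : Fin n → ℝ) :
    EuclideanSpace ℝ G.Horizontal :=
  WithLp.toLp 2 (fun j => fderiv ℝ φ x (G.X j x))

/-- A homogeneous (quasi-)norm on the group. -/
structure IsHomogeneousNorm (N : (Fin n → ℝ) → ℝ) : Prop where
  continuous : Continuous N
  nonneg : ∀ x, 0 ≤ N x
  eq_zero_iff : ∀ x, N x = 0 ↔ x = 0
  map_inv : ∀ x, N (G.inv x) = N x
  map_dilation : ∀ δ : ℝ, 0 < δ → ∀ x, N (G.dilation δ x) = δ * N x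

/-- `φ ∈ C_c^∞(Ω)`. -/
structure IsTestFunction (Ω : Set (Fin n → ℝ)) (φ : (Fin n → ℝ) → ℝ) : Prop where
  contDiff : ContDiff ℝ ∞ φ
  hasCompactSupport : HasCompactSupport φ
  tsupport_subset : tsupport φ ⊆ Ω

/-- `g` is the weak horizontal gradient of `v` in `Ω`: `∫_Ω v X_jφ = -∫_Ω g_j φ` for all test
functions `φ`.  (The fields `X_j` are divergence free.) -/
structure IsWeakHGrad (Ω : Set (Fin n → ℝ)) (v : (Fin n → ℝ) → ℝ)
    (g : (Fin n → ℝ) → EuclideanSpace ℝ G.Horizontal) : Prop where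
  locallyIntegrableOn : LocallyIntegrableOn v Ω
  locallyIntegrableOn_grad : LocallyIntegrableOn g Ω
  integral_eq : ∀ φ, IsTestFunction Ω φ → ∀ j : G.Horizontal,
    ∫ x in Ω, v x * fderiv ℝ φ x (G.X j x) = - ∫ x in Ω, g x j * φ x

/-- `v ∈ W_0^{1,p}(Ω)`: the function `v` belongs to `W^{1,p}(Ω)` and is a limit of functions of
`C_c^∞(Ω)` with respect to the norm `‖v‖_p + ‖∇_𝔾 v‖_p`. -/
def MemW0 (Ω : Set (Fin n → ℝ)) (p : ℝ) (v : (Fin n → ℝ) → ℝ) : Prop :=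
  MemLp v (ENNReal.ofReal p) (volume.restrict Ω) ∧
  ∃ g : (Fin n → ℝ) → EuclideanSpace ℝ G.Horizontal,
    G.IsWeakHGrad Ω v g ∧ MemLp g (ENNReal.ofReal p) (volume.restrict Ω) ∧
    ∃ φ : ℕ → (Fin n → ℝ) → ℝ, (∀ k, IsTestFunction Ω (φ k)) ∧
      Tendsto (fun k => eLpNorm (fun x => φ k x - v x) (ENNReal.ofReal p) (volume.restrict Ω))
        atTop (𝓝 0) ∧
      Tendsto (fun k => eLpNorm (fun x => G.hgrad (φ k) x - g x) (ENNReal.ofReal p)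
        (volume.restrict Ω)) atTop (𝓝 0)

/-- The Gagliardo type double integral
`∬_{A × A} |u(x) - u(y)|^p / |y⁻¹ · x|^{Q + p s} dx dy`, with values in `[0, ∞]`. -/
noncomputable def gagliardo (N : (Fin n → ℝ) → ℝ) (s p : ℝ) (A : Set (Fin n → ℝ))
    (u : (Fin n → ℝ) → ℝ) : ℝ≥0∞ :=
  ∫⁻ x in A, ∫⁻ y in A,
    ENNReal.ofReal (|u x - u y| ^ p / N (G.mul (G.inv y) x) ^ ((G.homDim : ℝ) + p * s))

end GradedGroup

/-- A stratified Lie group (homogeneous Carnot group) on `ℝⁿ`: Hörmander's rank condition holds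
for the left invariant vector fields `X_1, …, X_{n₁}` at every point. -/
structure StratifiedGroup (n : ℕ) extends GradedGroup n where
  hormander : ∀ x : Fin n → ℝ,
    Submodule.span ℝ {w | ∃ V, toGradedGroup.IsIteratedCommutator V ∧ V x = w} = ⊤

/-! A single constant serves all exponents. Since left translations preserve Lebesgue measure, the
substitution y = x·z (with |z⁻¹| = |z|) turns the double integral over 𝔾 × 𝔾 into ∫ |z|^{-Q-ps}
‖v(·z) - v‖_p^p dz (`gagliardo_univ_eq`), so everything rests on bounding ‖v(·z) - v‖_p by A
min(|z|, 1) ‖∇v‖_p with A independent of p.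

For small z, a form of Chow's theorem (`exists_reach`) writes z as a product of endpoints of
horizontal integral curves, or inverses of such, of total length at most C|z|. Along one curve the
fundamental theorem of calculus, Hölder's inequality and invariance under right translations give
the bound with constant exactly the length; products and inverses follow because right translations
are L^p isometries (`Reach.eLpNorm_sub_le`). For large z one uses 2‖v‖_p and a Poincaré inequality,
obtained from a fixed z₀ whose right translation moves Ω off itself.

Finally min(r,1) ≤ r^s makes min(|z|,1)^p / |z|^{Q+ps} at most min(|z|,1) / |z|^{Q+s}, an integrable
kernel free of p. Fatou's lemma carries the estimate from test functions to W_0^{1,p}. -/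

theorem measurePreserving_of_det_fderiv_eq_one {n : ℕ} {f : (Fin n → ℝ) → (Fin n → ℝ)}
    (hf : Differentiable ℝ f) (hb : Function.Bijective f)
    (hdet : ∀ x, (fderiv ℝ f x).det = 1) : MeasurePreserving f := by
  refine ⟨hf.continuous.measurable, Measure.ext fun s hs => ?_⟩
  rw [Measure.map_apply hf.continuous.measurable hs]
  have h := lintegral_abs_det_fderiv_eq_addHaar_image volume
    (hf.continuous.measurable hs)
    (fun x _ => (hf x).hasFDerivAt.hasFDerivWithinAt) hb.injective.injOn
  rw [Set.image_preimage_eq s hb.surjective] at h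
  simpa [hdet] using h

/-! ### Dilations, translations and Lebesgue measure. -/

namespace GradedGroup

variable {n : ℕ} (G : GradedGroup n)

/-- The dilation `T_δ` as a continuous linear map. -/
noncomputable def dilationL (δ : ℝ) : (Fin n → ℝ) →L[ℝ] (Fin n → ℝ) :=
  LinearMap.toContinuousLinearMap (Matrix.toLin' (Matrix.diagonal fun j => δ ^ G.deg j))

theorem dilationL_apply (δ : ℝ) (x : Fin n → ℝ) : G.dilationL δ x = G.dilation δ x := by
  ext j
  simp [dilationL, dilation, Matrix.mulVec_diagonal]

theorem det_dilationL (δ : ℝ) : (G.dilationL δ).det = δ ^ G.homDim := by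
  rw [ContinuousLinearMap.det, dilationL, LinearMap.coe_toContinuousLinearMap,
    LinearMap.det_toLin', Matrix.det_diagonal, Finset.prod_pow_eq_pow_sum, homDim]

theorem dilation_dilation (a b : ℝ) (x : Fin n → ℝ) :
    G.dilation a (G.dilation b x) = G.dilation (a * b) x := by
  ext j
  simp [dilation, mul_pow, _root_.mul_assoc]

theorem dilation_one (x : Fin n → ℝ) : G.dilation 1 x = x := by
  ext j
  simp [dilation]

theorem dilation_zero (δ : ℝ) : G.dilation δ 0 = 0 := by
  ext j
  simp [dilation]

theorem zero_dilation (x : Fin n → ℝ) : G.dilation 0 x = 0 := by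
  ext j
  have := G.one_le_deg j
  simp [dilation, zero_pow (show G.deg j ≠ 0 by omega)]

theorem continuous_dilation_left (x : Fin n → ℝ) : Continuous fun δ => G.dilation δ x := by
  unfold dilation
  fun_prop

theorem mul_dilation {δ : ℝ} (hδ : 0 < δ) (x y : Fin n → ℝ) :
    G.mul (G.dilation δ x) (G.dilation δ y) = G.dilation δ (G.mul x y) :=
  (G.dilation_mul δ hδ x y).symm

theorem inv_eq_of_mul_eq_zero {x y : Fin n → ℝ} (h : G.mul x y = 0) : G.inv x = y := by
  have := congrArg (G.mul (G.inv x)) h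
  rwa [← G.mul_assoc, G.inv_mul, G.zero_mul, G.mul_zero, eq_comm] at this

theorem inv_zero : G.inv 0 = 0 := G.inv_eq_of_mul_eq_zero (G.mul_zero 0)

theorem inv_inv (x : Fin n → ℝ) : G.inv (G.inv x) = x :=
  G.inv_eq_of_mul_eq_zero (G.inv_mul x)

theorem inv_mul_rev (x y : Fin n → ℝ) : G.inv (G.mul x y) = G.mul (G.inv y) (G.inv x) := by
  apply G.inv_eq_of_mul_eq_zero
  rw [G.mul_assoc, ← G.mul_assoc y, G.mul_inv, G.zero_mul, G.mul_inv]

theorem inv_dilation {δ : ℝ} (hδ : 0 < δ) (x : Fin n → ℝ) :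
    G.inv (G.dilation δ x) = G.dilation δ (G.inv x) := by
  apply G.inv_eq_of_mul_eq_zero
  rw [G.mul_dilation hδ, G.mul_inv, G.dilation_zero]

theorem inv_mul_cancel_left (x y : Fin n → ℝ) : G.mul (G.inv x) (G.mul x y) = y := by
  rw [← G.mul_assoc, G.inv_mul, G.zero_mul]

theorem mul_inv_cancel_left (x y : Fin n → ℝ) : G.mul x (G.mul (G.inv x) y) = y := by
  rw [← G.mul_assoc, G.mul_inv, G.zero_mul]

theorem mul_inv_cancel_right (x y : Fin n → ℝ) : G.mul (G.mul x y) (G.inv y) = x := by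
  rw [G.mul_assoc, G.mul_inv, G.mul_zero]

theorem inv_mul_cancel_right (x y : Fin n → ℝ) : G.mul (G.mul x (G.inv y)) y = x := by
  rw [G.mul_assoc, G.inv_mul, G.mul_zero]

theorem _root_.ContDiff.groupMul {E : Type*} [NormedAddCommGroup E] [NormedSpace ℝ E]
    {f g : E → (Fin n → ℝ)} (hf : ContDiff ℝ ∞ f) (hg : ContDiff ℝ ∞ g) :
    ContDiff ℝ ∞ fun t => G.mul (f t) (g t) :=
  G.contDiff_mul.comp (hf.prodMk hg)

theorem _root_.Continuous.groupMul {E : Type*} [TopologicalSpace E]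
    {f g : E → (Fin n → ℝ)} (hf : Continuous f) (hg : Continuous g) :
    Continuous fun t => G.mul (f t) (g t) :=
  G.contDiff_mul.continuous.comp (hf.prodMk hg)

theorem contDiff_mul_left (a : Fin n → ℝ) : ContDiff ℝ ∞ (G.mul a) :=
  contDiff_const.groupMul G contDiff_id

theorem contDiff_mul_right (a : Fin n → ℝ) : ContDiff ℝ ∞ fun x => G.mul x a :=
  contDiff_id.groupMul G contDiff_const

theorem bijective_mul_left (a : Fin n → ℝ) : Function.Bijective (G.mul a) :=
  Function.bijective_iff_has_inverse.2
    ⟨G.mul (G.inv a), G.inv_mul_cancel_left a, G.mul_inv_cancel_left a⟩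

theorem bijective_mul_right (a : Fin n → ℝ) : Function.Bijective fun x => G.mul x a :=
  Function.bijective_iff_has_inverse.2
    ⟨fun x => G.mul x (G.inv a), fun x => G.mul_inv_cancel_right x a,
      fun x => G.inv_mul_cancel_right x a⟩

/-- A smooth family of maps which commutes with the dilations and starts at the identity has
Jacobian determinant `1`. -/
theorem det_fderiv_eq_one_of_dilation (F : (Fin n → ℝ) → (Fin n → ℝ) → (Fin n → ℝ))
    (hF : ContDiff ℝ ∞ fun z : (Fin n → ℝ) × (Fin n → ℝ) => F z.1 z.2)
    (hF0 : ∀ x, F 0 x = x)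
    (hFδ : ∀ δ : ℝ, 0 < δ → ∀ a x, F (G.dilation δ a) (G.dilation δ x) = G.dilation δ (F a x))
    (a x : Fin n → ℝ) : (fderiv ℝ (F a) x).det = 1 := by
  have hd (a) : Differentiable ℝ (F a) :=
    (hF.comp (contDiff_const.prodMk contDiff_id) : ContDiff ℝ ∞ (F a)).differentiable (by simp)
  have hcont : Continuous fun z : (Fin n → ℝ) × (Fin n → ℝ) => (fderiv ℝ (F z.1) z.2).det := by
    have h1 : Continuous fun z : (Fin n → ℝ) × (Fin n → ℝ) => fderiv ℝ (F z.1) z.2 := by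
      have : ContDiff ℝ 0 fun z : (Fin n → ℝ) × (Fin n → ℝ) => fderiv ℝ (F z.1) z.2 := by
        refine ContDiff.fderiv (m := ∞) (n := 0) ?_ contDiff_snd (by simp)
        exact hF.comp ((contDiff_fst.comp contDiff_fst).prodMk contDiff_snd)
      exact this.continuous
    exact ContinuousLinearMap.continuous_det.comp h1
  -- The chain rule for F(T_δ a) ∘ T_δ = T_δ ∘ F(a) puts det T_δ ≠ 0 on both sides, so it cancels
  -- and the Jacobian is constant along dilation orbits. As δ → 0 it tends to its value at (0, 0),
  -- where F(0) is the identity.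
  have hconst : ∀ δ : ℝ, 0 < δ →
      (fderiv ℝ (F (G.dilation δ a)) (G.dilation δ x)).det = (fderiv ℝ (F a) x).det := by
    intro δ hδ
    have e : (fun y => F (G.dilation δ a) (G.dilationL δ y)) = fun y => G.dilationL δ (F a y) := by
      ext1 y
      rw [dilationL_apply, dilationL_apply, hFδ δ hδ]
    have h1 : HasFDerivAt (fun y => F (G.dilation δ a) (G.dilationL δ y))
        ((fderiv ℝ (F (G.dilation δ a)) (G.dilation δ x)).comp (G.dilationL δ)) x := by
      have := (hd (G.dilation δ a) (G.dilationL δ x)).hasFDerivAt.comp x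
        (G.dilationL δ).hasFDerivAt
      rwa [dilationL_apply] at this
    have h2 : HasFDerivAt (fun y => G.dilationL δ (F a y))
        ((G.dilationL δ).comp (fderiv ℝ (F a) x)) x :=
      (G.dilationL δ).hasFDerivAt.comp x (hd a x).hasFDerivAt
    rw [e] at h1
    have h3 := congrArg ContinuousLinearMap.det (h1.unique h2)
    simp only [ContinuousLinearMap.det, ContinuousLinearMap.toLinearMap_comp,
      LinearMap.det_comp] at h3
    have h4 : LinearMap.det (G.dilationL δ : (Fin n → ℝ) →ₗ[ℝ] (Fin n → ℝ)) ≠ 0 := by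
      have := G.det_dilationL δ
      rw [ContinuousLinearMap.det] at this
      rw [this]
      positivity
    rw [mul_comm] at h3
    exact mul_left_cancel₀ h4 h3
  have ht : Tendsto (fun δ : ℝ => (fderiv ℝ (F (G.dilation δ a)) (G.dilation δ x)).det)
      (𝓝[>] 0) (𝓝 1) := by
    have hc : Continuous fun δ : ℝ => (fderiv ℝ (F (G.dilation δ a)) (G.dilation δ x)).det :=
      hcont.comp ((G.continuous_dilation_left a).prodMk (G.continuous_dilation_left x))
    have := hc.tendsto 0
    rw [zero_dilation, zero_dilation, show F 0 = id from funext hF0, fderiv_id] at this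
    simpa [ContinuousLinearMap.det] using this.mono_left nhdsWithin_le_nhds
  refine tendsto_nhds_unique (tendsto_const_nhds.congr' ?_) ht
  filter_upwards [self_mem_nhdsWithin] with δ hδ using (hconst δ hδ).symm

theorem measurePreserving_mul_left (a : Fin n → ℝ) : MeasurePreserving (G.mul a) :=
  measurePreserving_of_det_fderiv_eq_one ((G.contDiff_mul_left a).differentiable (by simp))
    (G.bijective_mul_left a) fun x => G.det_fderiv_eq_one_of_dilation G.mul G.contDiff_mul
      G.zero_mul (fun _ hδ => G.mul_dilation hδ) a x

theorem measurePreserving_mul_right (a : Fin n → ℝ) : MeasurePreserving fun x => G.mul x a :=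
  measurePreserving_of_det_fderiv_eq_one ((G.contDiff_mul_right a).differentiable (by simp))
    (G.bijective_mul_right a) fun x => G.det_fderiv_eq_one_of_dilation (fun a x => G.mul x a)
      (contDiff_snd.groupMul G contDiff_fst) G.mul_zero
      (fun _ hδ a x => G.mul_dilation hδ x a) a x

theorem measurableEmbedding_mul_left (a : Fin n → ℝ) : MeasurableEmbedding (G.mul a) :=
  (G.contDiff_mul_left a).continuous.measurableEmbedding (G.bijective_mul_left a).injective

theorem measurableEmbedding_mul_right (a : Fin n → ℝ) :
    MeasurableEmbedding fun x => G.mul x a :=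
  (G.contDiff_mul_right a).continuous.measurableEmbedding (G.bijective_mul_right a).injective

theorem lintegral_mul_left (a : Fin n → ℝ) (f : (Fin n → ℝ) → ℝ≥0∞) :
    ∫⁻ x, f (G.mul a x) = ∫⁻ x, f x :=
  (G.measurePreserving_mul_left a).lintegral_comp_emb (G.measurableEmbedding_mul_left a) f

theorem lintegral_mul_right (a : Fin n → ℝ) (f : (Fin n → ℝ) → ℝ≥0∞) :
    ∫⁻ x, f (G.mul x a) = ∫⁻ x, f x :=
  (G.measurePreserving_mul_right a).lintegral_comp_emb (G.measurableEmbedding_mul_right a) f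

theorem volume_image_dilation {δ : ℝ} (hδ : 0 ≤ δ) (s : Set (Fin n → ℝ)) :
    volume (G.dilation δ '' s) = ENNReal.ofReal (δ ^ G.homDim) * volume s := by
  have h := Measure.addHaar_image_continuousLinearMap volume (G.dilationL δ) s
  change _ = ENNReal.ofReal |(G.dilationL δ).det| * _ at h
  rw [det_dilationL, abs_of_nonneg (by positivity)] at h
  rw [← h]
  congr 1
  ext y
  simp [dilationL_apply]

end GradedGroup

/-! ### Homogeneous norms and integrability of the kernel. -/

namespace GradedGroup

variable {n : ℕ} (G : GradedGroup n)

theorem exists_norm_dilation_eq {z : Fin n → ℝ} (hz : z ≠ 0) {ε : ℝ} (hε : 0 < ε) :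
    ∃ δ : ℝ, 0 < δ ∧ ‖G.dilation δ z‖ = ε := by
  obtain ⟨j, hj⟩ : ∃ j, z j ≠ 0 := by
    by_contra! h
    exact hz (funext h)
  have hj' : 0 < |z j| := abs_pos.2 hj
  set M := max 1 (ε / |z j|) with hM
  have hM1 : 1 ≤ M := le_max_left _ _
  have hc : Continuous fun δ => ‖G.dilation δ z‖ := (G.continuous_dilation_left z).norm
  have hfM : ε ≤ ‖G.dilation M z‖ := by
    refine le_trans ?_ (norm_le_pi_norm _ j)
    rw [dilation, Real.norm_eq_abs, abs_mul, abs_of_pos (by positivity)]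
    have h1 : M ≤ M ^ G.deg j := le_self_pow₀ hM1 (by have := G.one_le_deg j; omega)
    have h2 : ε ≤ M * |z j| := (div_le_iff₀ hj').1 (le_max_right _ _)
    exact h2.trans (mul_le_mul_of_nonneg_right h1 hj'.le)
  have hf0 : ‖G.dilation 0 z‖ = 0 := by rw [zero_dilation, norm_zero]
  obtain ⟨δ, hδ, h⟩ := intermediate_value_Icc (by linarith : (0 : ℝ) ≤ M) hc.continuousOn
    ⟨by rw [hf0]; exact hε.le, hfM⟩
  refine ⟨δ, lt_of_le_of_ne hδ.1 ?_, h⟩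
  rintro rfl
  simp only [hf0] at h
  exact hε.ne h

variable {G} {N : (Fin n → ℝ) → ℝ}

theorem IsHomogeneousNorm.pos (hN : G.IsHomogeneousNorm N) {z : Fin n → ℝ} (hz : z ≠ 0) :
    0 < N z :=
  lt_of_le_of_ne (hN.nonneg z) fun h => hz ((hN.eq_zero_iff z).1 h.symm)

/-- On the compact Euclidean sphere of radius ε the norm has a positive minimum, and homogeneity
spreads this bound over each dilation orbit. It lets a property known near 0 be rescaled to any z at
a cost proportional to N z; no triangle inequality is involved. -/
theorem IsHomogeneousNorm.exists_dilation (hN : G.IsHomogeneousNorm N) {ε : ℝ} (hε : 0 < ε) :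
    ∃ m : ℝ, 0 < m ∧ ∀ z, z ≠ 0 → ∃ δ : ℝ, 0 < δ ∧ ‖G.dilation δ z‖ = ε ∧ δ⁻¹ ≤ m * N z := by
  obtain ⟨m, hm, hmN⟩ : ∃ m : ℝ, 0 < m ∧ ∀ x, ‖x‖ = ε → m ≤ N x := by
    rcases (Metric.sphere (0 : Fin n → ℝ) ε).eq_empty_or_nonempty with h | h
    · refine ⟨1, one_pos, fun x hx => ?_⟩
      have : x ∈ Metric.sphere (0 : Fin n → ℝ) ε := by simpa using hx
      simp [h] at this
    · obtain ⟨x, hx, hmin⟩ := (isCompact_sphere (0 : Fin n → ℝ) ε).exists_isMinOn h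
        hN.continuous.continuousOn
      have hx0 : x ≠ 0 := by
        rintro rfl
        simp at hx
        exact hε.ne hx
      exact ⟨N x, hN.pos hx0, fun y hy => hmin (by simpa using hy)⟩
  refine ⟨m⁻¹, inv_pos.2 hm, fun z hz => ?_⟩
  obtain ⟨δ, hδ, h⟩ := G.exists_norm_dilation_eq hz hε
  refine ⟨δ, hδ, h, ?_⟩
  have := hmN _ h
  rw [hN.map_dilation δ hδ] at this
  rw [inv_mul_eq_div, inv_eq_one_div, div_le_div_iff₀ hδ hm]
  linarith

theorem IsHomogeneousNorm.volume_le_one_lt_top (hN : G.IsHomogeneousNorm N) :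
    volume {z | N z ≤ 1} < ⊤ := by
  obtain ⟨m, hm, h⟩ := hN.exists_dilation one_pos
  have hc : Continuous fun q : ℝ × (Fin n → ℝ) => G.dilation q.1 q.2 := by
    unfold dilation
    fun_prop
  have hK := ((isCompact_Icc (a := (0 : ℝ)) (b := m)).prod
    (isCompact_closedBall (0 : Fin n → ℝ) 1)).image hc
  refine lt_of_le_of_lt (measure_mono fun z hz => ?_) hK.measure_lt_top
  rcases eq_or_ne z 0 with rfl | hz0
  · exact ⟨(0, 0), by simp [hm.le], by simp [dilation_zero]⟩
  · obtain ⟨δ, hδ, h1, h2⟩ := h z hz0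
    refine ⟨(δ⁻¹, G.dilation δ z), ⟨⟨by positivity, ?_⟩, by simp [h1]⟩, ?_⟩
    · exact h2.trans (mul_le_of_le_one_right hm.le hz)
    · simp [dilation_dilation, inv_mul_cancel₀ hδ.ne', dilation_one]

theorem IsHomogeneousNorm.volume_le (hN : G.IsHomogeneousNorm N) {r : ℝ} (hr : 0 < r) :
    volume {z | N z ≤ r} = ENNReal.ofReal (r ^ G.homDim) * volume {z | N z ≤ 1} := by
  rw [← G.volume_image_dilation hr.le]
  congr 1
  ext z
  constructor
  · intro hz
    refine ⟨G.dilation r⁻¹ z, ?_, ?_⟩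
    · simp only [Set.mem_ofPred_eq] at hz ⊢
      rw [hN.map_dilation _ (inv_pos.2 hr), inv_mul_eq_div]
      exact (div_le_one hr).2 hz
    · rw [dilation_dilation, mul_inv_cancel₀ hr.ne', dilation_one]
  · rintro ⟨w, hw, rfl⟩
    simp only [Set.mem_ofPred_eq] at hw ⊢
    rw [hN.map_dilation _ hr]
    exact mul_le_of_le_one_right hr.le hw

/-- The terms compare with 2^{-ks} as k → ∞, which needs s > 0, and with 2^{(1-s)k} as k → -∞, which
needs s < 1. -/
theorem summable_min_two_zpow {s : ℝ} (hs₀ : 0 < s) (hs₁ : s < 1) :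
    Summable fun k : ℤ => min ((2 : ℝ) ^ (k + 1)) 1 / ((2 : ℝ) ^ k) ^ s := by
  have h2 (k : ℤ) : 0 < ((2 : ℝ) ^ k) ^ s := by positivity
  refine Summable.of_nat_of_neg ?_ ?_
  · refine Summable.of_nonneg_of_le (fun k => by positivity) (fun k => ?_)
      (summable_geometric_of_lt_one (r := (2 : ℝ) ^ (-s)) (by positivity)
        (Real.rpow_lt_one_of_one_lt_of_neg (by norm_num) (by linarith)))
    refine (div_le_div_of_nonneg_right (min_le_right _ _) (h2 _).le).trans (le_of_eq ?_)
    rw [zpow_natCast, one_div, ← Real.rpow_natCast, ← Real.rpow_natCast, ← Real.rpow_mul (by norm_num),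
      ← Real.rpow_mul (by norm_num), ← Real.rpow_neg (by norm_num)]
    ring_nf
  · refine Summable.of_nonneg_of_le (fun k => by positivity) (fun k => ?_)
      ((summable_geometric_of_lt_one (r := (2 : ℝ) ^ (s - 1)) (by positivity)
        (Real.rpow_lt_one_of_one_lt_of_neg (by norm_num) (by linarith))).mul_left 2)
    refine (div_le_div_of_nonneg_right (min_le_left _ _) (h2 _).le).trans (le_of_eq ?_)
    rw [zpow_add₀ (by norm_num), zpow_one, ← Real.rpow_intCast, ← Real.rpow_natCast,
      ← Real.rpow_mul (by norm_num), ← Real.rpow_mul (by norm_num), mul_comm _ (2 : ℝ),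
      mul_div_assoc, ← Real.rpow_sub (by norm_num)]
    congr 2
    push_cast
    ring

/-- The kernel `min(|z|, 1) / |z|^{Q + s}` is integrable. -/
theorem IsHomogeneousNorm.lintegral_kernel_lt_top (hN : G.IsHomogeneousNorm N) {s : ℝ}
    (hs₀ : 0 < s) (hs₁ : s < 1) :
    ∫⁻ z, ENNReal.ofReal (min (N z) 1 / N z ^ ((G.homDim : ℝ) + s)) < ⊤ := by
  set f : (Fin n → ℝ) → ℝ≥0∞ :=
    fun z => ENNReal.ofReal (min (N z) 1 / N z ^ ((G.homDim : ℝ) + s))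
  set S : ℤ → Set (Fin n → ℝ) := fun k => {z | N z ∈ Set.Ico ((2 : ℝ) ^ k) ((2 : ℝ) ^ (k + 1))}
  set a : ℤ → ℝ := fun k => min ((2 : ℝ) ^ (k + 1)) 1 / ((2 : ℝ) ^ k) ^ s with ha
  set V := volume {z | N z ≤ 1}
  -- On the dyadic shell the volume is at most 2^{(k+1)Q} V; its factor 2^{kQ} cancels the Q in the
  -- exponent of the kernel and leaves a k times 2^Q V.
  have hS (k : ℤ) : ∫⁻ z in S k, f z ≤ ENNReal.ofReal (a k) * (ENNReal.ofReal (2 ^ G.homDim) * V) := by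
    have hmeas : MeasurableSet (S k) := hN.continuous.measurable measurableSet_Ico
    have h2 : (0 : ℝ) < 2 ^ k := by positivity
    calc ∫⁻ z in S k, f z
        ≤ ∫⁻ z in S k, ENNReal.ofReal (min ((2 : ℝ) ^ (k + 1)) 1 /
            ((2 : ℝ) ^ k) ^ ((G.homDim : ℝ) + s)) := by
          refine setLIntegral_mono measurable_const fun z hz => ENNReal.ofReal_le_ofReal ?_
          have hz1 : (2 : ℝ) ^ k ≤ N z := hz.1
          have hz2 : N z < (2 : ℝ) ^ (k + 1) := hz.2
          gcongr
      _ = ENNReal.ofReal (min ((2 : ℝ) ^ (k + 1)) 1 / ((2 : ℝ) ^ k) ^ ((G.homDim : ℝ) + s)) *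
            volume (S k) := by simp
      _ ≤ ENNReal.ofReal (min ((2 : ℝ) ^ (k + 1)) 1 / ((2 : ℝ) ^ k) ^ ((G.homDim : ℝ) + s)) *
            (ENNReal.ofReal (((2 : ℝ) ^ (k + 1)) ^ G.homDim) * V) := by
          gcongr
          rw [← hN.volume_le (by positivity)]
          exact measure_mono fun z hz => hz.2.le
      _ = _ := by
          rw [← _root_.mul_assoc, ← _root_.mul_assoc, ← ENNReal.ofReal_mul (by positivity),
            ← ENNReal.ofReal_mul (by positivity)]
          congr 2
          have e : (2 : ℝ) ^ (k + 1) = 2 ^ k * 2 := zpow_add_one₀ (by norm_num) k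
          simp only [ha, Real.rpow_add h2, Real.rpow_natCast, e, mul_pow]
          field_simp
  have hcover : Set.univ ⊆ {z | N z = 0} ∪ ⋃ k, S k := by
    intro z _
    rcases (hN.nonneg z).eq_or_lt with h | h
    · exact Or.inl h.symm
    · obtain ⟨k, hk⟩ := exists_mem_Ico_zpow h (one_lt_two : (1 : ℝ) < 2)
      exact Or.inr (Set.mem_iUnion.2 ⟨k, hk⟩)
  have h0 : ∫⁻ z in {z | N z = 0}, f z = 0 := by
    have hm : MeasurableSet {z | N z = 0} := hN.continuous.measurable (measurableSet_singleton 0)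
    rw [setLIntegral_congr_fun (g := fun _ => 0) hm, lintegral_zero]
    intro z hz
    have : N z = 0 := hz
    simp [f, this]
  calc ∫⁻ z, f z = ∫⁻ z in Set.univ, f z := by simp
    _ ≤ ∫⁻ z in {z | N z = 0} ∪ ⋃ k, S k, f z := lintegral_mono_set hcover
    _ ≤ (∫⁻ z in {z | N z = 0}, f z) + ∫⁻ z in ⋃ k, S k, f z := lintegral_union_le _ _ _
    _ ≤ 0 + ∑' k, ∫⁻ z in S k, f z := by
        rw [h0]
        gcongr
        exact lintegral_iUnion_le _ _
    _ ≤ ∑' k, ENNReal.ofReal (a k) * (ENNReal.ofReal (2 ^ G.homDim) * V) := by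
        rw [_root_.zero_add]
        exact ENNReal.tsum_le_tsum hS
    _ = (∑' k, ENNReal.ofReal (a k)) * (ENNReal.ofReal (2 ^ G.homDim) * V) := ENNReal.tsum_mul_right
    _ < ⊤ := by
        refine ENNReal.mul_lt_top ?_ (ENNReal.mul_lt_top ENNReal.ofReal_lt_top
          hN.volume_le_one_lt_top)
        exact (summable_min_two_zpow hs₀ hs₁).tsum_ofReal_lt_top

end GradedGroup

/-! ### Left invariant fields, their brackets and the adjoint action. -/

namespace GradedGroup

variable {n : ℕ} (G : GradedGroup n)

/-- The left invariant vector field with value `w` at `0`. -/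
noncomputable def leftField (w x : Fin n → ℝ) : Fin n → ℝ := fderiv ℝ (G.mul x) 0 w

/-- The derivative at `0` of the right translation by `h`. -/
noncomputable def rightDeriv (h : Fin n → ℝ) : (Fin n → ℝ) →L[ℝ] (Fin n → ℝ) :=
  fderiv ℝ (fun x => G.mul x h) 0

/-- The conjugation `x ↦ h · x · h⁻¹`. -/
def conj (h x : Fin n → ℝ) : Fin n → ℝ := G.mul (G.mul h x) (G.inv h)

/-- The adjoint action: the derivative at `0` of the conjugation by `h`. -/
noncomputable def adjoint (h : Fin n → ℝ) : (Fin n → ℝ) →L[ℝ] (Fin n → ℝ) :=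
  fderiv ℝ (G.conj h) 0

/-- The derivative of the multiplication at the point `z`. -/
noncomputable def mulDeriv (z : (Fin n → ℝ) × (Fin n → ℝ)) :
    (Fin n → ℝ) × (Fin n → ℝ) →L[ℝ] (Fin n → ℝ) :=
  fderiv ℝ (fun z : (Fin n → ℝ) × (Fin n → ℝ) => G.mul z.1 z.2) z

theorem hasStrictFDerivAt_mul (z : (Fin n → ℝ) × (Fin n → ℝ)) :
    HasStrictFDerivAt (fun z : (Fin n → ℝ) × (Fin n → ℝ) => G.mul z.1 z.2) (G.mulDeriv z) z :=
  G.contDiff_mul.contDiffAt.hasStrictFDerivAt (by simp)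

theorem contDiff_mulDeriv : ContDiff ℝ ∞ G.mulDeriv :=
  G.contDiff_mul.fderiv_right (by simp)

theorem differentiable_mul_left (a : Fin n → ℝ) : Differentiable ℝ (G.mul a) :=
  (G.contDiff_mul_left a).differentiable (by simp)

theorem contDiff_conj (h : Fin n → ℝ) : ContDiff ℝ ∞ (G.conj h) :=
  (G.contDiff_mul_left h).groupMul G contDiff_const

theorem leftField_eq (w x : Fin n → ℝ) : G.leftField w x = G.mulDeriv (x, 0) (0, w) := by
  have h : HasFDerivAt (G.mul x) ((G.mulDeriv (x, 0)).comp
      (ContinuousLinearMap.inr ℝ (Fin n → ℝ) (Fin n → ℝ))) 0 :=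
    (G.hasStrictFDerivAt_mul (x, 0)).hasFDerivAt.comp (0 : Fin n → ℝ) (hasFDerivAt_prodMk_right x 0)
  rw [leftField, h.fderiv]
  rfl

theorem rightDeriv_eq (h : Fin n → ℝ) : G.rightDeriv h =
    (G.mulDeriv (0, h)).comp (ContinuousLinearMap.inl ℝ (Fin n → ℝ) (Fin n → ℝ)) :=
  HasFDerivAt.fderiv <| (G.hasStrictFDerivAt_mul (0, h)).hasFDerivAt.comp (0 : Fin n → ℝ)
    (f := fun x => (x, h)) (hasFDerivAt_prodMk_left (0 : Fin n → ℝ) h)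

theorem leftField_zero (w : Fin n → ℝ) : G.leftField w 0 = w := by
  rw [leftField, show G.mul 0 = id from funext G.zero_mul, fderiv_id]
  rfl

theorem rightDeriv_zero : G.rightDeriv 0 = ContinuousLinearMap.id ℝ _ := by
  rw [rightDeriv, show (fun x => G.mul x 0) = id from funext G.mul_zero, fderiv_id]

theorem adjoint_zero : G.adjoint 0 = ContinuousLinearMap.id ℝ _ := by
  have : G.conj 0 = id := by
    ext1 x
    rw [conj, G.inv_zero, G.zero_mul, G.mul_zero]
    rfl
  rw [adjoint, this, fderiv_id]

theorem mulDeriv_zero (u w : Fin n → ℝ) : G.mulDeriv (0, 0) (u, w) = u + w := by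
  have h1 := G.leftField_eq w 0
  rw [leftField_zero] at h1
  have h2 := DFunLike.congr_fun (G.rightDeriv_eq 0) u
  rw [rightDeriv_zero] at h2
  have h3 : G.mulDeriv (0, 0) (u, 0) = u := h2.symm
  have : ((u, w) : (Fin n → ℝ) × (Fin n → ℝ)) = (u, 0) + (0, w) := by simp
  rw [this, map_add, ← h1, h3]

theorem contDiff_leftField (w : Fin n → ℝ) : ContDiff ℝ ∞ (G.leftField w) := by
  rw [show G.leftField w = fun x => G.mulDeriv (x, 0) (0, w) from funext (G.leftField_eq w)]
  exact (G.contDiff_mulDeriv.comp (contDiff_id.prodMk contDiff_const)).clm_apply contDiff_const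

theorem differentiable_leftField (w : Fin n → ℝ) : Differentiable ℝ (G.leftField w) :=
  (G.contDiff_leftField w).differentiable (by simp)

theorem fderiv_mul_left_leftField (a w x : Fin n → ℝ) :
    fderiv ℝ (G.mul a) x (G.leftField w x) = G.leftField w (G.mul a x) := by
  have h : HasFDerivAt (fun y => G.mul a (G.mul x y))
      ((fderiv ℝ (G.mul a) (G.mul x 0)).comp (fderiv ℝ (G.mul x) 0)) 0 :=
    (G.differentiable_mul_left a (G.mul x 0)).hasFDerivAt.comp (0 : Fin n → ℝ)
      (G.differentiable_mul_left x 0).hasFDerivAt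
  rw [G.mul_zero] at h
  simp_rw [← G.mul_assoc] at h
  rw [leftField, leftField, h.fderiv]
  rfl

theorem isInvertible_fderiv_mul_left (a x : Fin n → ℝ) :
    (fderiv ℝ (G.mul a) x).IsInvertible := by
  have key (a x : Fin n → ℝ) : (fderiv ℝ (G.mul (G.inv a)) (G.mul a x)).comp
      (fderiv ℝ (G.mul a) x) = ContinuousLinearMap.id ℝ _ := by
    have h : HasFDerivAt (fun y => G.mul (G.inv a) (G.mul a y)) _ x :=
      (G.differentiable_mul_left (G.inv a) (G.mul a x)).hasFDerivAt.comp x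
        (G.differentiable_mul_left a x).hasFDerivAt
    simp_rw [G.inv_mul_cancel_left] at h
    exact h.unique (hasFDerivAt_id x)
  refine ContinuousLinearMap.IsInvertible.of_inverse (g := fderiv ℝ (G.mul (G.inv a)) (G.mul a x))
    ?_ (key a x)
  have := key (G.inv a) (G.mul a x)
  rwa [G.inv_inv, G.inv_mul_cancel_left] at this

theorem pullback_leftField (a w : Fin n → ℝ) :
    VectorField.pullback ℝ (G.mul a) (G.leftField w) = G.leftField w := by
  ext1 x
  rw [VectorField.pullback, ← fderiv_mul_left_leftField]
  exact (G.isInvertible_fderiv_mul_left a x).inverse_apply_eq.2 rfl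

/-- Pullback commutes with the bracket, and left translations fix both fields, so the bracket is
again left invariant and is determined by its value at 0. -/
theorem lieBracket_leftField (u w : Fin n → ℝ) :
    VectorField.lieBracket ℝ (G.leftField u) (G.leftField w) =
      G.leftField (VectorField.lieBracket ℝ (G.leftField u) (G.leftField w) 0) := by
  ext1 a
  have h := VectorField.pullback_lieBracket (𝕜 := ℝ) (n := ∞) (x := (0 : Fin n → ℝ))
    (by
      rw [minSmoothness_of_isRCLikeNormedField]
      exact WithTop.coe_le_coe.2 le_top)
    (G.contDiff_mul_left a).contDiffAt (G.differentiable_leftField u _)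
    (G.differentiable_leftField w _)
  rw [pullback_leftField, pullback_leftField, VectorField.pullback, G.mul_zero] at h
  rw [← h, leftField]
  exact ((G.isInvertible_fderiv_mul_left a 0).inverse_apply_eq.1 rfl)

theorem IsIteratedCommutator.eq_leftField {V : (Fin n → ℝ) → (Fin n → ℝ)}
    (hV : G.IsIteratedCommutator V) : V = G.leftField (V 0) := by
  induction hV with
  | base j =>
    have : G.X j = G.leftField (Pi.single j.1 1) := rfl
    rw [this, leftField_zero]
  | bracket V W _ _ hV hW =>
    rw [hV, hW]
    exact G.lieBracket_leftField _ _

/-- Differentiate h·x = (h·x·h⁻¹)·h at x = 0. This factorization allows the adjoint action to be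
differentiated by the product rule. -/
theorem rightDeriv_adjoint (h w : Fin n → ℝ) :
    G.rightDeriv h (G.adjoint h w) = G.leftField w h := by
  have hc : G.conj h 0 = 0 := by rw [conj, G.mul_zero, G.mul_inv]
  have h1 : HasFDerivAt (fun x => G.mul (G.conj h x) h)
      ((fderiv ℝ (fun x => G.mul x h) (G.conj h 0)).comp (G.adjoint h)) 0 :=
    ((G.contDiff_mul_right h).differentiable (by simp) (G.conj h 0)).hasFDerivAt.comp
      (0 : Fin n → ℝ) ((G.contDiff_conj h).differentiable (by simp) 0).hasFDerivAt
  rw [hc] at h1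
  have e : (fun x => G.mul (G.conj h x) h) = G.mul h := by
    ext1 x
    rw [conj, G.inv_mul_cancel_right]
  rw [e] at h1
  rw [leftField, h1.fderiv]
  rfl

theorem differentiable_adjoint (w : Fin n → ℝ) :
    Differentiable ℝ fun h => G.adjoint h w := by
  have h1 (h : Fin n → ℝ) : G.adjoint h w = G.mulDeriv (h, G.inv h) (G.leftField w h, 0) := by
    have h2 : HasFDerivAt (G.conj h) (((G.mulDeriv (G.mul h 0, G.inv h)).comp
        (ContinuousLinearMap.inl ℝ (Fin n → ℝ) (Fin n → ℝ))).comp (fderiv ℝ (G.mul h) 0)) 0 :=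
      ((G.hasStrictFDerivAt_mul (G.mul h 0, G.inv h)).hasFDerivAt.comp (G.mul h 0)
        (f := fun x => (x, G.inv h)) (hasFDerivAt_prodMk_left (G.mul h 0) (G.inv h))).comp
        (0 : Fin n → ℝ) (G.differentiable_mul_left h 0).hasFDerivAt
    rw [adjoint, h2.fderiv, G.mul_zero]
    rfl
  rw [funext h1]
  have h3 : ContDiff ℝ ∞ fun h => G.mulDeriv (h, G.inv h) (G.leftField w h, 0) :=
    (G.contDiff_mulDeriv.comp (contDiff_id.prodMk G.contDiff_inv)).clm_apply
      ((G.contDiff_leftField w).prodMk contDiff_const)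
  exact h3.differentiable (by simp)

/-- The derivative of Ad is ad. Differentiating X_w(h) = R_h Ad(h) w at h = 0 in the direction u
gives DX_w(0)u = (DR(0)u)w + (D Ad(0)u)w. Symmetry of the second derivative of the multiplication
identifies (DR(0)u)w with DX_u(0)w, and the remaining difference is the bracket. -/
theorem fderiv_adjoint_zero (u w : Fin n → ℝ) :
    fderiv ℝ (fun h => G.adjoint h w) 0 u =
      VectorField.lieBracket ℝ (G.leftField u) (G.leftField w) 0 := by
  set B := fderiv ℝ G.mulDeriv ((0 : Fin n → ℝ), (0 : Fin n → ℝ))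
  have hB : HasFDerivAt G.mulDeriv B ((0 : Fin n → ℝ), (0 : Fin n → ℝ)) :=
    (G.contDiff_mulDeriv.differentiable (by simp) _).hasFDerivAt
  have hsymm : IsSymmSndFDerivAt ℝ (fun z : (Fin n → ℝ) × (Fin n → ℝ) => G.mul z.1 z.2)
      ((0 : Fin n → ℝ), (0 : Fin n → ℝ)) :=
    G.contDiff_mul.contDiffAt.isSymmSndFDerivAt (by
      rw [minSmoothness_of_isRCLikeNormedField]
      exact WithTop.coe_le_coe.2 le_top)
  have hleft : fderiv ℝ (G.leftField u) 0 w = B (w, 0) (0, u) := by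
    have h1 : HasFDerivAt (fun x => G.mulDeriv (x, 0))
        (B.comp (ContinuousLinearMap.inl ℝ (Fin n → ℝ) (Fin n → ℝ))) (0 : Fin n → ℝ) :=
      hB.comp (0 : Fin n → ℝ) (f := fun x => (x, (0 : Fin n → ℝ))) (hasFDerivAt_prodMk_left _ _)
    have h2 := h1.clm_apply (hasFDerivAt_const ((0 : Fin n → ℝ), u) (0 : Fin n → ℝ))
    rw [show G.leftField u = fun x => G.mulDeriv (x, 0) (0, u) from funext (G.leftField_eq u),
      h2.fderiv]
    simp
  have hright : HasFDerivAt G.rightDeriv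
      (((ContinuousLinearMap.compL ℝ (Fin n → ℝ) ((Fin n → ℝ) × (Fin n → ℝ)) (Fin n → ℝ)).flip
        (ContinuousLinearMap.inl ℝ (Fin n → ℝ) (Fin n → ℝ))).comp
        (B.comp (ContinuousLinearMap.inr ℝ (Fin n → ℝ) (Fin n → ℝ)))) 0 := by
    rw [show G.rightDeriv = fun h => (G.mulDeriv (0, h)).comp
      (ContinuousLinearMap.inl ℝ (Fin n → ℝ) (Fin n → ℝ)) from funext G.rightDeriv_eq]
    have h1 : HasFDerivAt (fun x => G.mulDeriv (0, x))
        (B.comp (ContinuousLinearMap.inr ℝ (Fin n → ℝ) (Fin n → ℝ))) (0 : Fin n → ℝ) :=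
      hB.comp (0 : Fin n → ℝ) (hasFDerivAt_prodMk_right 0 0)
    exact (((ContinuousLinearMap.compL ℝ (Fin n → ℝ) ((Fin n → ℝ) × (Fin n → ℝ))
      (Fin n → ℝ)).flip (ContinuousLinearMap.inl ℝ (Fin n → ℝ) (Fin n → ℝ))).hasFDerivAt).comp
      (0 : Fin n → ℝ) h1
  have hprod := hright.clm_apply (G.differentiable_adjoint w 0).hasFDerivAt
  rw [show (fun h => G.rightDeriv h (G.adjoint h w)) = G.leftField w from
    funext fun h => G.rightDeriv_adjoint h w] at hprod
  have h4 := DFunLike.congr_fun hprod.fderiv u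
  simp only [rightDeriv_zero, adjoint_zero] at h4
  have h5 : B (w, 0) (0, u) = B (0, u) (w, 0) := hsymm (w, 0) (0, u)
  rw [VectorField.lieBracket, leftField_zero, leftField_zero, hleft, h5, h4]
  simp

end GradedGroup

/-! ### Reachable points and Chow's theorem. -/

namespace GradedGroup

variable {n : ℕ} (G : GradedGroup n)

/-- `G.Reach c z`: the point `z` is a product of endpoints of integral curves of the horizontal
fields, or inverses of such endpoints, of total length at most `c`. -/
inductive Reach : ℝ → (Fin n → ℝ) → Prop
  | curve (j : G.Horizontal) (γ : ℝ → (Fin n → ℝ)) (t : ℝ) (h0 : γ 0 = 0)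
      (h : ∀ τ ∈ Set.uIcc 0 t, HasDerivAt γ (G.X j (γ τ)) τ) : Reach |t| (γ t)
  | zero : Reach 0 0
  | mul {a b : ℝ} {x y : Fin n → ℝ} : Reach a x → Reach b y → Reach (a + b) (G.mul x y)
  | inv {a : ℝ} {x : Fin n → ℝ} : Reach a x → Reach a (G.inv x)
  | mono {a b : ℝ} {x : Fin n → ℝ} : Reach a x → a ≤ b → Reach b x

/-- Differentiate T_δ x · T_δ y = T_δ(x·y) at y = 0 along e_j, where T_δ e_j = δ e_j because j has
degree 1. Hence T_δ sends integral curves of X_j to integral curves with time multiplied by δ. -/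
theorem X_dilation (j : G.Horizontal) {δ : ℝ} (hδ : 0 < δ) (x : Fin n → ℝ) :
    δ • G.X j (G.dilation δ x) = G.dilation δ (G.X j x) := by
  have h1 : HasFDerivAt (fun y => G.mul (G.dilation δ x) (G.dilationL δ y))
      ((fderiv ℝ (G.mul (G.dilation δ x)) 0).comp (G.dilationL δ)) 0 := by
    have := (G.differentiable_mul_left (G.dilation δ x) (G.dilationL δ 0)).hasFDerivAt.comp
      (0 : Fin n → ℝ) (G.dilationL δ).hasFDerivAt
    rwa [map_zero] at this
  have h2 : HasFDerivAt (fun y => G.dilationL δ (G.mul x y))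
      ((G.dilationL δ).comp (fderiv ℝ (G.mul x) 0)) 0 :=
    (G.dilationL δ).hasFDerivAt.comp (0 : Fin n → ℝ) (G.differentiable_mul_left x 0).hasFDerivAt
  have e : (fun y => G.mul (G.dilation δ x) (G.dilationL δ y)) =
      fun y => G.dilationL δ (G.mul x y) := by
    ext1 y
    rw [dilationL_apply, dilationL_apply, G.mul_dilation hδ]
  rw [e] at h1
  have h3 := DFunLike.congr_fun (h1.unique h2) (Pi.single j.1 1)
  have h4 : G.dilation δ (Pi.single j.1 1) = δ • Pi.single j.1 1 := by
    ext i
    by_cases hi : i = j.1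
    · subst hi
      simp [dilation, j.2]
    · simp [dilation, hi]
  simp only [ContinuousLinearMap.comp_apply, dilationL_apply, h4, map_smul] at h3
  exact h3

theorem Reach.dilation {c : ℝ} {z : Fin n → ℝ} (h : G.Reach c z) {δ : ℝ} (hδ : 0 < δ) :
    G.Reach (δ * c) (G.dilation δ z) := by
  induction h with
  | curve j γ t h0 h =>
    have := Reach.curve (G := G) j (fun τ => G.dilationL δ (γ (δ⁻¹ * τ))) (δ * t)
      (by simp [h0]) (fun τ hτ => by
        have hτ' : δ⁻¹ * τ ∈ Set.uIcc 0 t := by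
          have := Set.mem_image_of_mem (fun x => δ⁻¹ * x) hτ
          rw [Set.image_const_mul_uIcc] at this
          simpa [hδ.ne'] using this
        have h1 : HasDerivAt (fun τ => γ (δ⁻¹ * τ)) (δ⁻¹ • G.X j (γ (δ⁻¹ * τ))) τ :=
          (h _ hτ').scomp τ (by simpa using (hasDerivAt_id τ).const_mul δ⁻¹)
        have h2 := (G.dilationL δ).hasFDerivAt.comp_hasDerivAt τ h1
        rw [map_smul, dilationL_apply, ← G.X_dilation j hδ, smul_smul, inv_mul_cancel₀ hδ.ne',
          one_smul] at h2
        rw [dilationL_apply]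
        exact h2)
    rw [abs_mul, abs_of_pos hδ, dilationL_apply, ← _root_.mul_assoc, inv_mul_cancel₀ hδ.ne',
      one_mul] at this
    exact this
  | zero =>
    rw [dilation_zero, MulZeroClass.mul_zero]
    exact .zero
  | mul _ _ hx hy =>
    rw [← G.mul_dilation hδ, mul_add]
    exact hx.mul hy
  | inv _ hx =>
    rw [← G.inv_dilation hδ]
    exact hx.inv
  | mono _ hab hx => exact hx.mono (by gcongr)

/-- The vectors which are tangent at `0` to a curve of points which can be reached with bounded
length. -/
def tangentSpace : Submodule ℝ (Fin n → ℝ) where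
  carrier := {w | ∃ (γ : ℝ → (Fin n → ℝ)) (C : ℝ), γ 0 = 0 ∧ HasStrictDerivAt γ w 0 ∧
    ∀ᶠ t in 𝓝 0, G.Reach C (γ t)}
  zero_mem' := ⟨fun _ => 0, 0, rfl, hasStrictDerivAt_const _ _, .of_forall fun _ => .zero⟩
  add_mem' := by
    rintro u w ⟨γ, C, h0, hγ, hC⟩ ⟨η, D, h0', hη, hD⟩
    refine ⟨fun t => G.mul (γ t) (η t), C + D, by simp only [h0, h0', G.mul_zero], ?_, ?_⟩
    · have := (G.hasStrictFDerivAt_mul (γ 0, η 0)).comp_hasStrictDerivAt (0 : ℝ) (hγ.prodMk hη)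
      rw [h0, h0', mulDeriv_zero] at this
      exact this
    · filter_upwards [hC, hD] with t h1 h2 using h1.mul h2
  smul_mem' := by
    rintro c w ⟨γ, C, h0, hγ, hC⟩
    refine ⟨fun t => γ (c * t), C, by simp [h0], ?_, ?_⟩
    · refine HasStrictDerivAt.scomp (g₁ := γ) (h := fun t => c * t) 0 ?_ ?_
      · simpa using hγ
      · simpa using (hasStrictDerivAt_id (0 : ℝ)).const_mul c
    · have : Tendsto (fun t : ℝ => c * t) (𝓝 0) (𝓝 0) := by
        simpa using (continuous_const_mul c).tendsto (0 : ℝ)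
      exact this.eventually hC

/-- Conjugating a curve by h adds length 2c. This is why `tangentSpace` asks for a length bound
uniform in t instead of one proportional to t. -/
theorem adjoint_mem_tangentSpace {c : ℝ} {h w : Fin n → ℝ} (hh : G.Reach c h)
    (hw : w ∈ G.tangentSpace) : G.adjoint h w ∈ G.tangentSpace := by
  obtain ⟨γ, C, h0, hγ, hC⟩ := hw
  refine ⟨fun t => G.conj h (γ t), c + C + c, ?_, ?_, ?_⟩
  · simp only [h0, conj, G.mul_zero, G.mul_inv]
  · have h1 : HasStrictFDerivAt (G.conj h) (G.adjoint h) (γ 0) := by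
      rw [h0]
      exact (G.contDiff_conj h).contDiffAt.hasStrictFDerivAt (by simp)
    exact h1.comp_hasStrictDerivAt (0 : ℝ) hγ
  · filter_upwards [hC] with t ht using (hh.mul ht).mul hh.inv

/-- The quotients (Ad(γ(t))w - w)/t lie in the subspace, which is closed in finite dimension, and
they converge to the bracket. -/
theorem lieBracket_mem_tangentSpace {u w : Fin n → ℝ} (hu : u ∈ G.tangentSpace)
    (hw : w ∈ G.tangentSpace) :
    VectorField.lieBracket ℝ (G.leftField u) (G.leftField w) 0 ∈ G.tangentSpace := by
  obtain ⟨γ, C, h0, hγ, hC⟩ := hu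
  have h1 : HasFDerivAt (fun h => G.adjoint h w) (fderiv ℝ (fun h => G.adjoint h w) 0) (γ 0) := by
    rw [h0]
    exact (G.differentiable_adjoint w 0).hasFDerivAt
  have h2 := h1.comp_hasDerivAt (0 : ℝ) hγ.hasDerivAt
  rw [fderiv_adjoint_zero] at h2
  refine (Submodule.closed_of_finiteDimensional G.tangentSpace).mem_of_tendsto
    (hasDerivAt_iff_tendsto_slope.1 h2) ?_
  have h3 : ∀ᶠ t in 𝓝[≠] (0 : ℝ), G.Reach C (γ t) := nhdsWithin_le_nhds hC
  filter_upwards [h3] with t ht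
  refine G.tangentSpace.smul_mem _ (G.tangentSpace.sub_mem ?_ ?_)
  · exact G.adjoint_mem_tangentSpace ht hw
  · simp only [Function.comp_apply, h0, adjoint_zero]
    exact hw

theorem single_mem_tangentSpace (j : G.Horizontal) : Pi.single j.1 1 ∈ G.tangentSpace := by
  have hX : G.X j = G.leftField (Pi.single j.1 1) := rfl
  have hs : ContDiffAt ℝ 1 (G.X j) 0 := by
    rw [hX]
    exact ((G.contDiff_leftField _).of_le (by simp)).contDiffAt
  obtain ⟨γ, h0, ε, hε, hγ⟩ :=
    -- A local integral curve through 0 serves as the required curve: each of its points is reached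
    -- with length |t| < ε.
    hs.exists_forall_mem_closedBall_exists_eq_forall_mem_Ioo_hasDerivAt₀ 0
  rw [_root_.zero_sub, _root_.zero_add] at hγ
  have hev : ∀ᶠ t in 𝓝 (0 : ℝ), t ∈ Set.Ioo (-ε) ε := Ioo_mem_nhds (by linarith) hε
  refine ⟨γ, ε, h0, ?_, ?_⟩
  · have h1 := hasStrictDerivAt_of_hasDerivAt_of_continuousAt (hev.mono hγ) (by
      refine ContinuousAt.comp (g := G.X j) ?_ (hγ 0 ⟨by linarith, hε⟩).continuousAt
      rw [hX]
      exact (G.contDiff_leftField _).continuous.continuousAt)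
    rwa [h0, hX, leftField_zero] at h1
  · filter_upwards [hev] with t ht
    refine Reach.mono (.curve j γ t h0 fun τ hτ => hγ τ ?_) (abs_lt.2 ht).le
    exact Set.ordConnected_Ioo.uIcc_subset ⟨by linarith, hε⟩ ht hτ

theorem IsIteratedCommutator.mem_tangentSpace {V : (Fin n → ℝ) → (Fin n → ℝ)}
    (hV : G.IsIteratedCommutator V) : V 0 ∈ G.tangentSpace := by
  induction hV with
  | base j =>
    have : G.X j = G.leftField (Pi.single j.1 1) := rfl
    rw [this, leftField_zero]
    exact G.single_mem_tangentSpace j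
  | bracket V W hV hW hV' hW' =>
    rw [hV.eq_leftField, hW.eq_leftField]
    exact G.lieBracket_mem_tangentSpace hV' hW'

/-- A product of curves, each with its own parameter, has as derivative at 0 the sum of t_i w_i.
Strict differentiability is kept so that the map can later be inverted locally. -/
theorem exists_product_map {w : Fin n → (Fin n → ℝ)} (hw : ∀ i, w i ∈ G.tangentSpace)
    (s : Finset (Fin n)) :
    ∃ (φ : (Fin n → ℝ) → (Fin n → ℝ)) (C : ℝ), φ 0 = 0 ∧
      HasStrictFDerivAt φ
        (∑ i ∈ s, (ContinuousLinearMap.proj (R := ℝ) (φ := fun _ : Fin n => ℝ) i).smulRight (w i)) 0 ∧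
      ∀ᶠ t in 𝓝 0, G.Reach C (φ t) := by
  induction s using Finset.induction_on with
  | empty =>
    refine ⟨fun _ => 0, 0, rfl, ?_, .of_forall fun _ => .zero⟩
    rw [Finset.sum_empty]
    exact hasStrictFDerivAt_const _ _
  | insert i s hi ih =>
    obtain ⟨φ, C, h0, hφ, hC⟩ := ih
    obtain ⟨γ, D, h0', hγ, hD⟩ := hw i
    have hp : HasStrictFDerivAt (fun t : Fin n → ℝ => γ (t i))
        ((ContinuousLinearMap.proj (R := ℝ) (φ := fun _ : Fin n => ℝ) i).smulRight (w i)) 0 := by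
      have h1 : HasStrictDerivAt γ (w i) ((ContinuousLinearMap.proj (R := ℝ)
        (φ := fun _ : Fin n => ℝ) i) 0) := by simpa using hγ
      refine (h1.hasStrictFDerivAt.comp (0 : Fin n → ℝ)
        (ContinuousLinearMap.proj (R := ℝ) (φ := fun _ : Fin n => ℝ) i).hasStrictFDerivAt).congr_fderiv ?_
      ext x
      simp
    refine ⟨fun t => G.mul (γ (t i)) (φ t), D + C, by simp [h0, h0', G.mul_zero], ?_, ?_⟩
    · have h2 := (G.hasStrictFDerivAt_mul (γ ((0 : Fin n → ℝ) i), φ 0)).comp (0 : Fin n → ℝ)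
        (hp.prodMk hφ)
      refine h2.congr_fderiv ?_
      rw [Finset.sum_insert hi]
      ext1 x
      simp only [Pi.zero_apply, h0, h0', ContinuousLinearMap.comp_apply,
        ContinuousLinearMap.prod_apply, mulDeriv_zero, _root_.add_apply]
    · have : Tendsto (fun t : Fin n → ℝ => t i) (𝓝 0) (𝓝 0) :=
        (continuous_apply i).tendsto (0 : Fin n → ℝ)
      filter_upwards [hC, this.eventually hD] with t h1 h2 using h2.mul h1

/-- For the standard basis the product map has the identity as strict derivative at 0, so it maps
neighbourhoods of 0 onto neighbourhoods of 0. -/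
theorem eventually_reach (h : G.tangentSpace = ⊤) : ∃ C, ∀ᶠ z in 𝓝 0, G.Reach C z := by
  obtain ⟨φ, C, h0, hφ, hC⟩ := G.exists_product_map (w := fun i => Pi.single i 1)
    (fun i => by rw [h]; trivial) Finset.univ
  refine ⟨C, ?_⟩
  have h1 : (∑ i, (ContinuousLinearMap.proj (R := ℝ) (φ := fun _ : Fin n => ℝ) i).smulRight
      (Pi.single i (1 : ℝ) : Fin n → ℝ)) = ContinuousLinearMap.id ℝ (Fin n → ℝ) := by
    ext x j
    simp [Finset.sum_apply, Pi.single_apply]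
  rw [h1] at hφ
  have h2 := hφ.map_nhds_eq_of_surj (by simp)
  rw [h0] at h2
  rw [← h2]
  exact hC

-- Lengths and N both scale by δ under T_δ, so the uniform bound near 0 becomes a global bound
-- linear in N z.
variable {G} in
theorem IsHomogeneousNorm.exists_reach {N : (Fin n → ℝ) → ℝ} (hN : G.IsHomogeneousNorm N)
    (h : G.tangentSpace = ⊤) : ∃ C : ℝ, 0 < C ∧ ∀ z, G.Reach (C * N z) z := by
  obtain ⟨C, hC⟩ := G.eventually_reach h
  obtain ⟨ε, hε, hball⟩ := Metric.eventually_nhds_iff.1 hC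
  obtain ⟨m, hm, hδ⟩ := hN.exists_dilation (half_pos hε)
  -- The maximum with 1 only ensures that the constant is positive.
  refine ⟨max C 1 * m, by positivity, fun z => ?_⟩
  rcases eq_or_ne z 0 with rfl | hz
  · rw [(hN.eq_zero_iff 0).2 rfl, MulZeroClass.mul_zero]
    exact .zero
  · obtain ⟨δ, hδ0, h1, h2⟩ := hδ z hz
    have h3 : G.Reach C (G.dilation δ z) := hball (by rw [dist_zero_right, h1]; linarith)
    have h4 := (h3.mono (le_max_left C 1)).dilation G (inv_pos.2 hδ0)
    rw [dilation_dilation, inv_mul_cancel₀ hδ0.ne', dilation_one] at h4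
    refine h4.mono ?_
    calc δ⁻¹ * max C 1 ≤ (m * N z) * max C 1 := by gcongr
      _ = _ := by ring

end GradedGroup

theorem StratifiedGroup.tangentSpace_eq_top {n : ℕ} (G : StratifiedGroup n) :
    G.tangentSpace = ⊤ := by
  rw [eq_top_iff, ← G.hormander 0, Submodule.span_le]
  rintro w ⟨V, hV, rfl⟩
  exact hV.mem_tangentSpace

/-! ### Horizontal gradient and right translations in L^q. -/

theorem rpow_lintegral_le {α : Type*} [MeasurableSpace α] {μ : Measure α} {f : α → ℝ≥0∞}
    (hf : AEMeasurable f μ) {q : ℝ} (hq : 1 < q) :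
    (∫⁻ a, f a ∂μ) ^ q ≤ μ Set.univ ^ (q - 1) * ∫⁻ a, f a ^ q ∂μ := by
  have hc := Real.HolderConjugate.conjExponent hq
  have h := ENNReal.lintegral_mul_le_Lp_mul_Lq μ hc hf (aemeasurable_const (b := (1 : ℝ≥0∞)))
  simp only [Pi.mul_apply, mul_one, ENNReal.one_rpow, lintegral_const, one_mul] at h
  have hq0 : 0 ≤ q := by linarith
  refine (ENNReal.rpow_le_rpow h hq0).trans (le_of_eq ?_)
  rw [ENNReal.mul_rpow_of_nonneg _ _ hq0, ← ENNReal.rpow_mul, ← ENNReal.rpow_mul, mul_comm,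
    one_div_mul_cancel (by linarith), ENNReal.rpow_one]
  congr 2
  rw [Real.conjExponent]
  have : q - 1 ≠ 0 := by linarith
  field_simp

namespace GradedGroup

variable {n : ℕ} (G : GradedGroup n)

theorem continuous_hgrad {v : (Fin n → ℝ) → ℝ} (hv : ContDiff ℝ ∞ v) : Continuous (G.hgrad v) := by
  refine (PiLp.continuous_toLp 2 _).comp (continuous_pi fun j => ?_)
  exact (hv.continuous_fderiv (by simp)).clm_apply
    (G.contDiff_leftField (Pi.single j.1 1)).continuous

theorem Reach.nonneg {c : ℝ} {z : Fin n → ℝ} (h : G.Reach c z) : 0 ≤ c := by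
  induction h with
  | curve => exact abs_nonneg _
  | zero => exact le_rfl
  | mul _ _ hx hy => exact add_nonneg hx hy
  | inv _ hx => exact hx
  | mono _ hab hx => exact hx.trans hab

/-- By left invariance y·γ is again an integral curve of X_j, so the derivative of v along it is one
component of the horizontal gradient. -/
theorem enorm_sub_le_lintegral_hgrad {v : (Fin n → ℝ) → ℝ} (hv : ContDiff ℝ ∞ v)
    {j : G.Horizontal} {γ : ℝ → (Fin n → ℝ)} {t : ℝ} (h0 : γ 0 = 0)
    (h : ∀ τ ∈ Set.uIcc 0 t, HasDerivAt γ (G.X j (γ τ)) τ) (y : Fin n → ℝ) :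
    ‖v (G.mul y (γ t)) - v y‖ₑ ≤ ∫⁻ τ in Set.uIoc 0 t, ‖G.hgrad v (G.mul y (γ τ))‖ₑ := by
  have hd : ∀ τ ∈ Set.uIcc 0 t, HasDerivAt (fun τ => v (G.mul y (γ τ)))
      (G.hgrad v (G.mul y (γ τ)) j) τ := by
    intro τ hτ
    have h1 := (G.differentiable_mul_left y (γ τ)).hasFDerivAt.comp_hasDerivAt τ (h τ hτ)
    have h2 := (hv.differentiable (by simp) (G.mul y (γ τ))).hasFDerivAt.comp_hasDerivAt τ h1
    have h3 : fderiv ℝ (G.mul y) (γ τ) (G.X j (γ τ)) = G.X j (G.mul y (γ τ)) :=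
      G.fderiv_mul_left_leftField y (Pi.single j.1 1) (γ τ)
    rw [h3] at h2
    exact h2
  have hγ : ContinuousOn γ (Set.uIcc 0 t) := fun τ hτ => (h τ hτ).continuousAt.continuousWithinAt
  have hcont : ContinuousOn (fun τ => G.hgrad v (G.mul y (γ τ)) j) (Set.uIcc 0 t) := by
    have : Continuous fun x => G.hgrad v (G.mul y x) j :=
      (EuclideanSpace.proj (𝕜 := ℝ) j).continuous.comp
        ((G.continuous_hgrad hv).comp (G.contDiff_mul_left y).continuous)
    exact this.comp_continuousOn hγ
  have hint := intervalIntegral.integral_eq_sub_of_hasDerivAt hd hcont.intervalIntegrable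
  rw [h0, G.mul_zero] at hint
  rw [← hint]
  calc ‖∫ τ in (0 : ℝ)..t, G.hgrad v (G.mul y (γ τ)) j‖ₑ
      = ‖∫ τ in Set.uIoc 0 t, G.hgrad v (G.mul y (γ τ)) j‖ₑ := by
        rw [← ofReal_norm, intervalIntegral.norm_intervalIntegral_eq, ofReal_norm]
    _ ≤ ∫⁻ τ in Set.uIoc 0 t, ‖G.hgrad v (G.mul y (γ τ)) j‖ₑ := enorm_integral_le_lintegral_enorm _
    _ ≤ _ := lintegral_mono fun τ => by
        rw [← ofReal_norm, ← ofReal_norm]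
        exact ENNReal.ofReal_le_ofReal (PiLp.norm_apply_le _ j)

/-- Hölder in τ costs |t|^{q-1}; after Tonelli, right invariance makes the y-integral independent of
τ, giving the last factor |t|. After the q-th root the constant is |t|, free of q. -/
theorem lintegral_enorm_sub_curve_le {v : (Fin n → ℝ) → ℝ} (hv : ContDiff ℝ ∞ v) {q : ℝ}
    (hq : 1 < q) {j : G.Horizontal} {γ : ℝ → (Fin n → ℝ)} {t : ℝ} (h0 : γ 0 = 0)
    (h : ∀ τ ∈ Set.uIcc 0 t, HasDerivAt γ (G.X j (γ τ)) τ) :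
    ∫⁻ y, ‖v (G.mul y (γ t)) - v y‖ₑ ^ q ≤
      ENNReal.ofReal |t| ^ q * ∫⁻ y, ‖G.hgrad v y‖ₑ ^ q := by
  have hq0 : 0 ≤ q := by linarith
  have hγ : ContinuousOn γ (Set.uIcc 0 t) := fun τ hτ => (h τ hτ).continuousAt.continuousWithinAt
  have hγm : AEMeasurable γ (volume.restrict (Set.uIoc 0 t)) :=
    (hγ.mono Set.uIoc_subset_uIcc).aemeasurable measurableSet_uIoc
  have hvol : volume.restrict (Set.uIoc 0 t) Set.univ = ENNReal.ofReal |t| := by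
    simp [Real.volume_uIoc]
  have hmeas : Measurable fun x => ‖G.hgrad v x‖ₑ := (G.continuous_hgrad hv).enorm.measurable
  calc ∫⁻ y, ‖v (G.mul y (γ t)) - v y‖ₑ ^ q
      ≤ ∫⁻ y, (∫⁻ τ in Set.uIoc 0 t, ‖G.hgrad v (G.mul y (γ τ))‖ₑ) ^ q := by
        gcongr with y
        exact G.enorm_sub_le_lintegral_hgrad hv h0 h y
    _ ≤ ∫⁻ y, ENNReal.ofReal |t| ^ (q - 1) *
          ∫⁻ τ in Set.uIoc 0 t, ‖G.hgrad v (G.mul y (γ τ))‖ₑ ^ q := by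
        gcongr with y
        rw [← hvol]
        refine rpow_lintegral_le (hmeas.comp_aemeasurable ?_) hq
        exact (G.contDiff_mul_left y).continuous.measurable.comp_aemeasurable hγm
    _ = ENNReal.ofReal |t| ^ (q - 1) *
          ∫⁻ y, ∫⁻ τ in Set.uIoc 0 t, ‖G.hgrad v (G.mul y (γ τ))‖ₑ ^ q :=
        lintegral_const_mul' _ _ (ENNReal.rpow_ne_top_of_nonneg (by linarith) ENNReal.ofReal_ne_top)
    _ = ENNReal.ofReal |t| ^ (q - 1) *
          ∫⁻ τ in Set.uIoc 0 t, ∫⁻ y, ‖G.hgrad v (G.mul y (γ τ))‖ₑ ^ q := by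
        rw [lintegral_lintegral_swap]
        refine (hmeas.comp_aemeasurable ?_).pow_const q
        exact G.contDiff_mul.continuous.measurable.comp_aemeasurable
          (measurable_fst.aemeasurable.prodMk hγm.comp_snd)
    _ = ENNReal.ofReal |t| ^ (q - 1) * (ENNReal.ofReal |t| * ∫⁻ y, ‖G.hgrad v y‖ₑ ^ q) := by
        congr 1
        simp_rw [G.lintegral_mul_right _ fun y => ‖G.hgrad v y‖ₑ ^ q]
        rw [lintegral_const, hvol, mul_comm]
    _ = _ := by
        rw [← _root_.mul_assoc]
        congr 1
        nth_rw 2 [← ENNReal.rpow_one (ENNReal.ofReal |t|)]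
        rw [← ENNReal.rpow_add_of_nonneg _ _ (by linarith) zero_le_one, sub_add_cancel]

variable {G} in
/-- The `L^p` modulus of continuity of a smooth function along right translations is controlled by
its horizontal gradient. -/
theorem Reach.eLpNorm_sub_le {c : ℝ} {z : Fin n → ℝ} (h : G.Reach c z)
    {v : (Fin n → ℝ) → ℝ} (hv : ContDiff ℝ ∞ v) {q : ℝ} (hq : 1 < q) :
    eLpNorm (fun y => v (G.mul y z) - v y) (ENNReal.ofReal q) volume ≤
      ENNReal.ofReal c * eLpNorm (G.hgrad v) (ENNReal.ofReal q) volume := by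
  have hq0 : 0 < q := by linarith
  have hcont (z : Fin n → ℝ) : Continuous fun y => v (G.mul y z) - v y :=
    (hv.continuous.comp (G.contDiff_mul_right z).continuous).sub hv.continuous
  have hq1 : 1 ≤ ENNReal.ofReal q := by simpa using hq.le
  induction h with
  | curve j γ t h0 h =>
    rw [eLpNorm_eq_lintegral_rpow_enorm_toReal (by simpa using hq0) ENNReal.ofReal_ne_top,
      eLpNorm_eq_lintegral_rpow_enorm_toReal (by simpa using hq0) ENNReal.ofReal_ne_top,
      ENNReal.toReal_ofReal hq0.le]
    refine (ENNReal.rpow_le_rpow (G.lintegral_enorm_sub_curve_le hv hq h0 h)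
      (by positivity)).trans (le_of_eq ?_)
    rw [ENNReal.mul_rpow_of_nonneg _ _ (by positivity), ← ENNReal.rpow_mul,
      mul_one_div_cancel hq0.ne', ENNReal.rpow_one]
  | zero => simp [G.mul_zero]
  | @mul a b x y hx hy ihx ihy =>
    have e : (fun w => v (G.mul w (G.mul x y)) - v w) =
        (fun w => v (G.mul (G.mul w x) y) - v (G.mul w x)) + fun w => v (G.mul w x) - v w := by
      ext w
      simp [G.mul_assoc]
    have e2 : eLpNorm (fun w => v (G.mul (G.mul w x) y) - v (G.mul w x)) (ENNReal.ofReal q) volume =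
        eLpNorm (fun w => v (G.mul w y) - v w) (ENNReal.ofReal q) volume :=
      eLpNorm_comp_measurePreserving (g := fun w => v (G.mul w y) - v w)
        (hcont y).aestronglyMeasurable (G.measurePreserving_mul_right x)
    rw [e, ENNReal.ofReal_add hx.nonneg hy.nonneg, add_mul, add_comm (ENNReal.ofReal a * _)]
    refine (eLpNorm_add_le ?_ (hcont x).aestronglyMeasurable hq1).trans
      (add_le_add (e2.trans_le ihy) ihx)
    exact ((hcont y).comp (G.contDiff_mul_right x).continuous).aestronglyMeasurable
  | @inv a x hx ih =>
    -- Substituting w·x for w turns the increment by x⁻¹ into minus the increment by x.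
    have e : eLpNorm (fun w => v (G.mul (G.mul w x) (G.inv x)) - v (G.mul w x))
        (ENNReal.ofReal q) volume = eLpNorm (fun w => v (G.mul w (G.inv x)) - v w)
          (ENNReal.ofReal q) volume :=
      eLpNorm_comp_measurePreserving (g := fun w => v (G.mul w (G.inv x)) - v w)
        (hcont _).aestronglyMeasurable (G.measurePreserving_mul_right x)
    simp_rw [G.mul_inv_cancel_right] at e
    rw [← e]
    refine le_trans (le_of_eq ?_) ih
    exact eLpNorm_sub_comm (fun w => v w) (fun w => v (G.mul w x)) _ _
  | mono _ hab ih => exact ih.trans (by gcongr)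

end GradedGroup

/-! ### The Gagliardo integral of test functions. -/

namespace GradedGroup

variable {n : ℕ} {G : GradedGroup n} {N : (Fin n → ℝ) → ℝ}

theorem IsHomogeneousNorm.gagliardo_univ_eq (hN : G.IsHomogeneousNorm N) {v : (Fin n → ℝ) → ℝ}
    (hv : Continuous v) (s : ℝ) {q : ℝ} (hq : 0 ≤ q) :
    G.gagliardo N s q Set.univ v =
      ∫⁻ z, ENNReal.ofReal (N z ^ ((G.homDim : ℝ) + q * s))⁻¹ *
        ∫⁻ x, ‖v (G.mul x z) - v x‖ₑ ^ q := by
  have hmul : Continuous fun p : (Fin n → ℝ) × (Fin n → ℝ) => G.mul p.1 p.2 :=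
    G.contDiff_mul.continuous
  have hmeas : Measurable fun p : (Fin n → ℝ) × (Fin n → ℝ) =>
      ENNReal.ofReal (N p.2 ^ ((G.homDim : ℝ) + q * s))⁻¹ *
        ‖v (G.mul p.1 p.2) - v p.1‖ₑ ^ q := by
    have h1 : Measurable fun p : (Fin n → ℝ) × (Fin n → ℝ) => N p.2 :=
      (hN.continuous.comp continuous_snd).measurable
    have h2 : Measurable fun p : (Fin n → ℝ) × (Fin n → ℝ) => ‖v (G.mul p.1 p.2) - v p.1‖ₑ :=
      ((hv.comp hmul).sub (hv.comp continuous_fst)).enorm.measurable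
    exact (h1.pow_const _).inv.ennreal_ofReal.mul (h2.pow_const q)
  calc G.gagliardo N s q Set.univ v
      = ∫⁻ x, ∫⁻ y, ENNReal.ofReal
          (|v x - v y| ^ q / N (G.mul (G.inv y) x) ^ ((G.homDim : ℝ) + q * s)) := by
        simp [gagliardo]
    _ = ∫⁻ x, ∫⁻ z, ENNReal.ofReal (N z ^ ((G.homDim : ℝ) + q * s))⁻¹ *
          ‖v (G.mul x z) - v x‖ₑ ^ q := by
        refine lintegral_congr fun x => ?_
        rw [← G.lintegral_mul_left x]
        refine lintegral_congr fun z => ?_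
        rw [G.inv_mul_rev, G.inv_mul_cancel_right, hN.map_inv, div_eq_inv_mul,
          ENNReal.ofReal_mul (inv_nonneg.2 (Real.rpow_nonneg (hN.nonneg z) _)),
          ← ENNReal.ofReal_rpow_of_nonneg (abs_nonneg _) hq, ← Real.norm_eq_abs, ofReal_norm,
          enorm_sub_rev]
    _ = ∫⁻ z, ∫⁻ x, ENNReal.ofReal (N z ^ ((G.homDim : ℝ) + q * s))⁻¹ *
          ‖v (G.mul x z) - v x‖ₑ ^ q := lintegral_lintegral_swap hmeas.aemeasurable
    _ = _ := by
        refine lintegral_congr fun z => ?_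
        exact lintegral_const_mul' _ _ ENNReal.ofReal_ne_top

/-- The quotient min(r,1)/r^s is at most 1, so raising it to a power q ≥ 1 only decreases it. This
removes q from the kernel. At r = 0 both numerators vanish. -/
theorem min_one_rpow_div_le {r s q d : ℝ} (hr : 0 ≤ r) (hs₀ : 0 < s) (hs₁ : s < 1) (hq : 1 ≤ q) :
    min r 1 ^ q / r ^ (d + q * s) ≤ min r 1 / r ^ (d + s) := by
  rcases hr.eq_or_lt with rfl | hr
  · rw [min_eq_left zero_le_one, Real.zero_rpow (by linarith)]
    simp
  · have hm : 0 < min r 1 := lt_min hr one_pos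
    have h1 : min r 1 / r ^ s ≤ 1 := by
      rw [div_le_one (by positivity)]
      rcases le_total r 1 with h | h
      · rw [min_eq_left h]
        exact Real.self_le_rpow_of_le_one hr.le h hs₁.le
      · rw [min_eq_right h]
        exact Real.one_le_rpow h hs₀.le
    have h2 : (min r 1 / r ^ s) ^ q ≤ min r 1 / r ^ s :=
      Real.rpow_le_self_of_le_one (by positivity) h1 hq
    rw [Real.div_rpow hm.le (by positivity), ← Real.rpow_mul hr.le] at h2
    rw [Real.rpow_add hr, Real.rpow_add hr, mul_comm q s, mul_comm (r ^ d), mul_comm (r ^ d),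
      ← div_div, ← div_div]
    gcongr

/-- The Gagliardo seminorm of a function whose modulus of continuity along right translations is
`A min(|z|, 1)`. -/
theorem IsHomogeneousNorm.gagliardo_univ_le (hN : G.IsHomogeneousNorm N) {v : (Fin n → ℝ) → ℝ}
    (hv : Continuous v) {s : ℝ} (hs₀ : 0 < s) (hs₁ : s < 1) {q : ℝ} (hq : 1 < q) {A : ℝ}
    (hA : 0 ≤ A) (D : ℝ≥0∞) (h : ∀ z, eLpNorm (fun y => v (G.mul y z) - v y) (ENNReal.ofReal q) volume ≤
      ENNReal.ofReal (A * min (N z) 1) * D) :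
    G.gagliardo N s q Set.univ v ≤ (ENNReal.ofReal A * D) ^ q *
      ∫⁻ z, ENNReal.ofReal (min (N z) 1 / N z ^ ((G.homDim : ℝ) + s)) := by
  have hq0 : 0 < q := by linarith
  have hmin (z : Fin n → ℝ) : 0 ≤ min (N z) 1 := le_min (hN.nonneg z) zero_le_one
  have h' (z : Fin n → ℝ) : ∫⁻ x, ‖v (G.mul x z) - v x‖ₑ ^ q ≤
      (ENNReal.ofReal A * D) ^ q * ENNReal.ofReal (min (N z) 1 ^ q) := by
    have h1 := h z
    rw [eLpNorm_eq_lintegral_rpow_enorm_toReal (by simpa using hq0) ENNReal.ofReal_ne_top,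
      ENNReal.toReal_ofReal hq0.le, one_div, ENNReal.rpow_inv_le_iff hq0] at h1
    refine h1.trans (le_of_eq ?_)
    rw [← ENNReal.ofReal_rpow_of_nonneg (hmin z) hq0.le, ← ENNReal.mul_rpow_of_nonneg _ _ hq0.le,
      ENNReal.ofReal_mul hA]
    ring_nf
  rw [hN.gagliardo_univ_eq hv s hq0.le]
  have hm : Measurable fun z => ENNReal.ofReal (min (N z) 1 / N z ^ ((G.homDim : ℝ) + s)) := by
    have := hN.continuous.measurable
    exact ((this.min measurable_const).div (this.pow_const _)).ennreal_ofReal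
  rw [← lintegral_const_mul _ hm]
  refine lintegral_mono fun z => ?_
  calc ENNReal.ofReal (N z ^ ((G.homDim : ℝ) + q * s))⁻¹ * ∫⁻ x, ‖v (G.mul x z) - v x‖ₑ ^ q
      ≤ ENNReal.ofReal (N z ^ ((G.homDim : ℝ) + q * s))⁻¹ *
        ((ENNReal.ofReal A * D) ^ q * ENNReal.ofReal (min (N z) 1 ^ q)) := by
        gcongr
        exact h' z
    _ = (ENNReal.ofReal A * D) ^ q *
        ENNReal.ofReal (min (N z) 1 ^ q / N z ^ ((G.homDim : ℝ) + q * s)) := by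
        rw [div_eq_mul_inv, ENNReal.ofReal_mul (Real.rpow_nonneg (hmin z) _)]
        ring
    _ ≤ _ := by
        gcongr _ * ENNReal.ofReal ?_
        exact min_one_rpow_div_le (hN.nonneg z) hs₀ hs₁ hq.le

variable (G) in
/-- A bounded set is disjoint from one of its right translates. -/
theorem exists_mul_notMem [Nonempty (Fin n)] {Ω : Set (Fin n → ℝ)} (hΩ : Bornology.IsBounded Ω) :
    ∃ z, ∀ y ∈ Ω, G.mul y z ∉ Ω := by
  have hK : IsCompact (closure Ω) := hΩ.isCompact_closure
  have hc : Continuous fun p : (Fin n → ℝ) × (Fin n → ℝ) => G.mul (G.inv p.1) p.2 :=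
    (G.contDiff_inv.continuous.comp continuous_fst).groupMul G continuous_snd
  have hK2 := (hK.prod hK).image hc
  obtain ⟨z, hz⟩ := (Set.ne_univ_iff_exists_notMem _).1 hK2.ne_univ
  refine ⟨z, fun y hy hyz => hz ⟨(y, G.mul y z), ⟨subset_closure hy, subset_closure hyz⟩, ?_⟩⟩
  exact G.inv_mul_cancel_left y z

theorem IsTestFunction.eq_zero {Ω : Set (Fin n → ℝ)} {v : (Fin n → ℝ) → ℝ}
    (hv : IsTestFunction Ω v) {x : Fin n → ℝ} (hx : x ∉ Ω) : v x = 0 :=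
  image_eq_zero_of_notMem_tsupport fun h => hx (hv.tsupport_subset h)

/-- Uniform fractional Poincaré inequality for test functions. -/
theorem IsHomogeneousNorm.exists_gagliardo_testFunction_le [Nonempty (Fin n)]
    (hN : G.IsHomogeneousNorm N) (hG : G.tangentSpace = ⊤) {Ω : Set (Fin n → ℝ)}
    (hΩ : Bornology.IsBounded Ω) {s : ℝ} (hs₀ : 0 < s) (hs₁ : s < 1) :
    ∃ K : ℝ, 0 < K ∧ ∀ q : ℝ, 1 < q → ∀ v, IsTestFunction Ω v →
      G.gagliardo N s q Set.univ v ≤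
        (ENNReal.ofReal K * eLpNorm (G.hgrad v) (ENNReal.ofReal q) volume) ^ q := by
  obtain ⟨C, hC, hreach⟩ := hN.exists_reach hG
  obtain ⟨z₀, hz₀⟩ := G.exists_mul_notMem hΩ
  set I := ∫⁻ z, ENNReal.ofReal (min (N z) 1 / N z ^ ((G.homDim : ℝ) + s)) with hI
  have hI' : I < ⊤ := hN.lintegral_kernel_lt_top hs₀ hs₁
  -- The first entry is used for N z ≤ 1, the second for N z ≥ 1.
  set A := max C (2 * (C * N z₀))
  have hA : 0 < A := lt_max_of_lt_left hC
  -- With the maximum, I ≤ (max 1 I)^q for every q > 1, which keeps the constant independent of q.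
  refine ⟨A * max 1 I.toReal, by positivity, fun q hq v hv => ?_⟩
  have hq0 : 0 < q := by linarith
  have hq1 : 1 ≤ ENNReal.ofReal q := by simpa using hq.le
  set D := eLpNorm (G.hgrad v) (ENNReal.ofReal q) volume
  have hvc := hv.contDiff.continuous
  have htrans (z : Fin n → ℝ) : eLpNorm (fun y => v (G.mul y z) - v y) (ENNReal.ofReal q) volume ≤
      ENNReal.ofReal (C * N z) * D := (hreach z).eLpNorm_sub_le hv.contDiff hq
  -- For y in Ω the point y·z₀ lies outside Ω, so |v(y)| is exactly the increment of v by z₀.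
  have hpoincare : eLpNorm v (ENNReal.ofReal q) volume ≤ ENNReal.ofReal (C * N z₀) * D := by
    refine le_trans (eLpNorm_mono_enorm_ae (ae_of_all _ fun y => ?_)) (htrans z₀)
    by_cases hy : y ∈ Ω
    · rw [hv.eq_zero (hz₀ y hy), _root_.zero_sub, enorm_neg]
    · simp [hv.eq_zero hy]
  have hfar (z : Fin n → ℝ) : eLpNorm (fun y => v (G.mul y z) - v y) (ENNReal.ofReal q) volume ≤
      ENNReal.ofReal (2 * (C * N z₀)) * D := by
    have h1 : eLpNorm (fun y => v (G.mul y z)) (ENNReal.ofReal q) volume =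
        eLpNorm v (ENNReal.ofReal q) volume :=
      eLpNorm_comp_measurePreserving hvc.aestronglyMeasurable (G.measurePreserving_mul_right z)
    refine (eLpNorm_sub_le (f := fun y => v (G.mul y z)) (g := v)
      (hvc.comp (G.contDiff_mul_right z).continuous).aestronglyMeasurable
      hvc.aestronglyMeasurable hq1).trans ?_
    rw [h1, ENNReal.ofReal_mul zero_le_two, ← two_mul, ENNReal.ofReal_ofNat, _root_.mul_assoc]
    gcongr
  have hall (z : Fin n → ℝ) : eLpNorm (fun y => v (G.mul y z) - v y) (ENNReal.ofReal q) volume ≤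
      ENNReal.ofReal (A * min (N z) 1) * D := by
    rcases le_total (N z) 1 with h | h
    · rw [min_eq_left h]
      refine (htrans z).trans ?_
      gcongr
      · exact hN.nonneg z
      · exact le_max_left _ _
    · rw [min_eq_right h, mul_one]
      refine (hfar z).trans ?_
      gcongr
      exact le_max_right _ _
  refine (hN.gagliardo_univ_le hvc hs₀ hs₁ hq hA.le D hall).trans ?_
  rw [ENNReal.ofReal_mul hA.le, mul_right_comm (ENNReal.ofReal A) _ D,
    ENNReal.mul_rpow_of_nonneg (ENNReal.ofReal A * D) _ hq0.le]
  gcongr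
  calc I = ENNReal.ofReal I.toReal := (ENNReal.ofReal_toReal hI'.ne).symm
    _ ≤ ENNReal.ofReal (max 1 I.toReal) := ENNReal.ofReal_le_ofReal (le_max_right _ _)
    _ ≤ ENNReal.ofReal (max 1 I.toReal) ^ q := by
        refine ENNReal.le_rpow_self_of_one_le ?_ hq.le
        simp

end GradedGroup

/-! ### Passage from test functions to W_0^{1,p}. -/

namespace GradedGroup

variable {n : ℕ} {G : GradedGroup n}

theorem IsHomogeneousNorm.measurable_gagliardo_integrand {N : (Fin n → ℝ) → ℝ}
    (hN : G.IsHomogeneousNorm N) {u : (Fin n → ℝ) → ℝ} (hu : Measurable u) (s q : ℝ) :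
    Measurable fun p : (Fin n → ℝ) × (Fin n → ℝ) =>
      ENNReal.ofReal (|u p.1 - u p.2| ^ q / N (G.mul (G.inv p.2) p.1) ^ ((G.homDim : ℝ) + q * s)) := by
  have h1 : Continuous fun p : (Fin n → ℝ) × (Fin n → ℝ) => N (G.mul (G.inv p.2) p.1) :=
    hN.continuous.comp ((G.contDiff_inv.continuous.comp continuous_snd).groupMul G continuous_fst)
  have h2 : Measurable fun p : (Fin n → ℝ) × (Fin n → ℝ) => |u p.1 - u p.2| :=
    ((hu.comp measurable_fst).sub (hu.comp measurable_snd)).norm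
  exact ((h2.pow_const q).div (h1.measurable.pow_const _)).ennreal_ofReal

/-- Fatou's lemma for the Gagliardo double integral. -/
theorem IsHomogeneousNorm.gagliardo_le_liminf {N : (Fin n → ℝ) → ℝ} (hN : G.IsHomogeneousNorm N)
    {u : (Fin n → ℝ) → ℝ} {φ : ℕ → (Fin n → ℝ) → ℝ} (hφ : ∀ k, Measurable (φ k))
    (h : ∀ᵐ x, Tendsto (fun k => φ k x) atTop (𝓝 (u x))) (s : ℝ) {q : ℝ} (hq : 0 < q) :
    G.gagliardo N s q Set.univ u ≤ liminf (fun k => G.gagliardo N s q Set.univ (φ k)) atTop := by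
  simp only [gagliardo, Measure.restrict_univ]
  let F : ℕ → (Fin n → ℝ) → (Fin n → ℝ) → ℝ≥0∞ := fun k x y => ENNReal.ofReal
    (|φ k x - φ k y| ^ q / N (G.mul (G.inv y) x) ^ ((G.homDim : ℝ) + q * s))
  have hm (k : ℕ) : Measurable (Function.uncurry (F k)) :=
    hN.measurable_gagliardo_integrand (hφ k) s q
  have hm' (k : ℕ) (x : Fin n → ℝ) : Measurable (F k x) :=
    (hm k).of_uncurry_left
  -- Fatou is applied twice, in y for almost every fixed x and then in x.
  calc _ ≤ ∫⁻ x, liminf (fun k => ∫⁻ y, F k x y) atTop := by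
        refine lintegral_mono_ae ?_
        filter_upwards [h] with x hx
        refine le_trans ?_ (lintegral_liminf_le fun k => hm' k x)
        refine lintegral_mono_ae ?_
        filter_upwards [h] with y hy
        refine le_of_eq (Tendsto.liminf_eq ?_).symm
        refine ENNReal.tendsto_ofReal (Tendsto.div_const ?_ _)
        exact ((hx.sub hy).abs).rpow_const (Or.inr hq.le)
    _ ≤ _ := lintegral_liminf_le fun k => (hm k).lintegral_prod_right'

theorem IsTestFunction.integral_mul_eq {Ω : Set (Fin n → ℝ)} {φ : (Fin n → ℝ) → ℝ}
    (hφ : IsTestFunction Ω φ) {f : (Fin n → ℝ) → ℝ} :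
    ∫ x, φ x * f x = ∫ x in Ω, f x * φ x := by
  rw [setIntegral_eq_integral_of_forall_compl_eq_zero fun x hx => by
    rw [hφ.eq_zero hx, MulZeroClass.mul_zero]]
  exact integral_congr_ae (ae_of_all _ fun x => mul_comm _ _)

theorem IsTestFunction.integrableOn_mul {Ω : Set (Fin n → ℝ)} {φ : (Fin n → ℝ) → ℝ}
    (hφ : IsTestFunction Ω φ) {f : (Fin n → ℝ) → ℝ} (hf : LocallyIntegrableOn f Ω) :
    IntegrableOn (fun x => f x * φ x) Ω := by
  have hK : IsCompact (tsupport φ) := hφ.hasCompactSupport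
  have h1 : IntegrableOn (fun x => f x * φ x) (tsupport φ) :=
    ((hf.mono_set hφ.tsupport_subset).integrableOn_isCompact hK).mul_continuousOn
      hφ.contDiff.continuous.continuousOn hK
  refine ((integrableOn_iff_integrable_of_support_subset fun x hx => ?_).1 h1).integrableOn
  exact subset_tsupport φ (right_ne_zero_of_mul hx)

/-- Weak horizontal gradients are unique. -/
theorem IsWeakHGrad.ae_eq {Ω : Set (Fin n → ℝ)} (hΩ : IsOpen Ω) {v : (Fin n → ℝ) → ℝ}
    {g g' : (Fin n → ℝ) → EuclideanSpace ℝ G.Horizontal} (hg : G.IsWeakHGrad Ω v g)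
    (hg' : G.IsWeakHGrad Ω v g') : g =ᵐ[volume.restrict Ω] g' := by
  have hloc {f : (Fin n → ℝ) → EuclideanSpace ℝ G.Horizontal} (hf : LocallyIntegrableOn f Ω)
      (j : G.Horizontal) : LocallyIntegrableOn (fun x => f x j) Ω := by
    intro x hx
    obtain ⟨U, hU, hfU⟩ := hf x hx
    exact ⟨U, hU, (EuclideanSpace.proj (𝕜 := ℝ) j).integrable_comp hfU⟩
  have key (j : G.Horizontal) : ∀ᵐ x, x ∈ Ω → g x j - g' x j = 0 := by
    have h1 := hloc hg.locallyIntegrableOn_grad j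
    have h2 := hloc hg'.locallyIntegrableOn_grad j
    refine hΩ.ae_eq_zero_of_integral_contDiff_smul_eq_zero (h1.sub h2) fun φ hφ hc hs => ?_
    have hT : IsTestFunction Ω φ := ⟨hφ, hc, hs⟩
    simp only [smul_eq_mul]
    rw [hT.integral_mul_eq (f := fun x => g x j - g' x j)]
    simp only [sub_mul]
    rw [integral_sub (hT.integrableOn_mul h1) (hT.integrableOn_mul h2)]
    have e1 := hg.integral_eq φ hT j
    have e2 := hg'.integral_eq φ hT j
    linarith
  rw [EventuallyEq, ae_restrict_iff' hΩ.measurableSet]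
  filter_upwards [ae_all_iff.2 key] with x hx hxΩ
  ext j
  exact sub_eq_zero.1 (hx j hxΩ)

theorem IsTestFunction.eLpNorm_hgrad_restrict {Ω : Set (Fin n → ℝ)} {φ : (Fin n → ℝ) → ℝ}
    (hφ : IsTestFunction Ω φ) (p : ℝ≥0∞) :
    eLpNorm (G.hgrad φ) p (volume.restrict Ω) = eLpNorm (G.hgrad φ) p volume := by
  refine eLpNorm_restrict_eq_of_support_subset fun x hx => ?_
  by_contra hxΩ
  refine hx ?_
  have h : fderiv ℝ φ x = 0 :=
    image_eq_zero_of_notMem_tsupport fun h => hxΩ (hφ.tsupport_subset (tsupport_fderiv_subset ℝ h))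
  ext j
  simp [hgrad, h]

theorem gagliardo_subsingleton [IsEmpty (Fin n)] (N : (Fin n → ℝ) → ℝ) (s : ℝ) {q : ℝ}
    (hq : 0 < q) (A : Set (Fin n → ℝ)) (u : (Fin n → ℝ) → ℝ) : G.gagliardo N s q A u = 0 := by
  have (x y : Fin n → ℝ) : u x - u y = 0 := by rw [Subsingleton.elim x y, sub_self]
  simp [gagliardo, this, Real.zero_rpow hq.ne']

theorem gagliardo_le_univ (N : (Fin n → ℝ) → ℝ) (s q : ℝ) (A : Set (Fin n → ℝ))
    (u : (Fin n → ℝ) → ℝ) : G.gagliardo N s q A u ≤ G.gagliardo N s q Set.univ u := by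
  unfold gagliardo
  rw [Measure.restrict_univ]
  exact lintegral_mono' Measure.restrict_le_self fun x =>
    lintegral_mono' Measure.restrict_le_self le_rfl

/-- A bound for the Gagliardo double integral passes from test functions to `W_0^{1,p}`. -/
theorem IsHomogeneousNorm.gagliardo_le_of_testFunction {N : (Fin n → ℝ) → ℝ}
    (hN : G.IsHomogeneousNorm N) {Ω : Set (Fin n → ℝ)} (hΩ : IsOpen Ω) {s K q : ℝ} (hq : 1 < q)
    (hK : ∀ φ, IsTestFunction Ω φ → G.gagliardo N s q Set.univ φ ≤
      (ENNReal.ofReal K * eLpNorm (G.hgrad φ) (ENNReal.ofReal q) volume) ^ q)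
    {v : (Fin n → ℝ) → ℝ} {g : (Fin n → ℝ) → EuclideanSpace ℝ G.Horizontal}
    (hv : G.MemW0 Ω q v) (hg : G.IsWeakHGrad Ω v g) :
    G.gagliardo N s q Set.univ (Ω.indicator v) ≤
      (ENNReal.ofReal K * eLpNorm g (ENNReal.ofReal q) (volume.restrict Ω)) ^ q := by
  have hq0 : 0 < q := by linarith
  have hq1 : 1 ≤ ENNReal.ofReal q := by simpa using hq.le
  obtain ⟨hvp, g', hg', hgp, φ, hφ, hφv, hφg⟩ := hv
  -- The gradient g' approximated by test functions need not be the given g; uniqueness identifies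
  -- their norms.
  rw [eLpNorm_congr_ae (hg.ae_eq hΩ hg')]
  obtain ⟨ns, hns, hae⟩ := (tendstoInMeasure_of_tendsto_eLpNorm
    (ne_of_gt (lt_of_lt_of_le one_pos hq1))
    (fun k => (hφ k).contDiff.continuous.aestronglyMeasurable) hvp.1 hφv).exists_seq_tendsto_ae
  -- Outside Ω the test functions and the zero extension all vanish, so convergence almost
  -- everywhere on Ω extends to the whole group.
  have hlim : ∀ᵐ x, Tendsto (fun k => φ (ns k) x) atTop (𝓝 (Ω.indicator v x)) := by
    rw [ae_restrict_iff' hΩ.measurableSet] at hae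
    filter_upwards [hae] with x hx
    by_cases hxΩ : x ∈ Ω
    · rw [Set.indicator_of_mem hxΩ]
      exact hx hxΩ
    · rw [Set.indicator_of_notMem hxΩ]
      simp only [(hφ _).eq_zero hxΩ]
      exact tendsto_const_nhds
  refine (hN.gagliardo_le_liminf (fun k => (hφ (ns k)).contDiff.continuous.measurable) hlim s
    hq0).trans ?_
  set D := eLpNorm g' (ENNReal.ofReal q) (volume.restrict Ω)
  set d : ℕ → ℝ≥0∞ := fun k =>
    eLpNorm (fun x => G.hgrad (φ k) x - g' x) (ENNReal.ofReal q) (volume.restrict Ω)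
  have hbound (k : ℕ) : G.gagliardo N s q Set.univ (φ (ns k)) ≤
      (ENNReal.ofReal K * (d (ns k) + D)) ^ q := by
    refine (hK _ (hφ (ns k))).trans ?_
    rw [← (hφ (ns k)).eLpNorm_hgrad_restrict]
    gcongr
    have hm := (G.continuous_hgrad (hφ (ns k)).contDiff).aestronglyMeasurable
      (μ := volume.restrict Ω)
    have := eLpNorm_add_le (hm.sub hgp.1) hgp.1 hq1
    rwa [sub_add_cancel] at this
  have htend : Tendsto (fun k => (ENNReal.ofReal K * (d (ns k) + D)) ^ q) atTop
      (𝓝 ((ENNReal.ofReal K * D) ^ q)) := by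
    have h1 : Tendsto (fun k => d (ns k) + D) atTop (𝓝 (0 + D)) :=
      (hφg.comp hns.tendsto_atTop).add tendsto_const_nhds
    rw [_root_.zero_add] at h1
    exact (ENNReal.continuous_rpow_const.tendsto _).comp
      (ENNReal.Tendsto.const_mul h1 (Or.inr ENNReal.ofReal_ne_top))
  rw [← htend.liminf_eq]
  exact liminf_le_liminf (Eventually.of_forall hbound)

end GradedGroup

theorem theorem2p4 {n : ℕ} (G : StratifiedGroup n)
    (N : (Fin n → ℝ) → ℝ) (hN : G.IsHomogeneousNorm N)
    (Ω : Set (Fin n → ℝ)) (hΩ_open : IsOpen Ω) (hΩ_conn : IsConnected Ω)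
    (hΩ_bdd : Bornology.IsBounded Ω)
    (s : ℝ) (hs₀ : 0 < s) (hs₁ : s < 1) :
    ∃ (C : ℝ → ℝ) (C_lim : ℝ), 0 < C_lim ∧ Tendsto C atTop (𝓝 C_lim) ∧
      ∀ p : ℝ, 1 < p →
        ∀ (v : (Fin n → ℝ) → ℝ) (g : (Fin n → ℝ) → EuclideanSpace ℝ G.Horizontal),
          G.MemW0 Ω p v → G.IsWeakHGrad Ω v g →
            (G.gagliardo N s p Ω (Ω.indicator v)) ^ (1 / p) ≤
                ENNReal.ofReal (C p) * eLpNorm g (ENNReal.ofReal p) (volume.restrict Ω) ∧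
            (G.gagliardo N s p Set.univ (Ω.indicator v)) ^ (1 / p) ≤
                ENNReal.ofReal (C p) * eLpNorm g (ENNReal.ofReal p) (volume.restrict Ω) := by
  suffices h : ∃ K : ℝ, 0 < K ∧ ∀ p : ℝ, 1 < p →
      ∀ (v : (Fin n → ℝ) → ℝ) (g : (Fin n → ℝ) → EuclideanSpace ℝ G.Horizontal),
        G.MemW0 Ω p v → G.IsWeakHGrad Ω v g →
          G.gagliardo N s p Set.univ (Ω.indicator v) ≤
            (ENNReal.ofReal K * eLpNorm g (ENNReal.ofReal p) (volume.restrict Ω)) ^ p by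
    obtain ⟨K, hK, h⟩ := h
    -- As K does not depend on p, the constant family C_p = K converges trivially.
    refine ⟨fun _ => K, K, hK, tendsto_const_nhds, fun p hp v g hv hg => ?_⟩
    have hp0 : 0 < p := by linarith
    have h1 := h p hp v g hv hg
    rw [one_div, ENNReal.rpow_inv_le_iff hp0, ENNReal.rpow_inv_le_iff hp0]
    exact ⟨(GradedGroup.gagliardo_le_univ N s p Ω _).trans h1, h1⟩
  -- In dimension 0 the group is a point and no translation moves Ω off itself, but the left side is
  -- zero.
  rcases isEmpty_or_nonempty (Fin n) with hn | hn
  · refine ⟨1, one_pos, fun p hp v g _ _ => ?_⟩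
    rw [GradedGroup.gagliardo_subsingleton N s (by linarith)]
    exact zero_le
  · obtain ⟨K, hK, h⟩ := hN.exists_gagliardo_testFunction_le G.tangentSpace_eq_top hΩ_bdd hs₀ hs₁
    exact ⟨K, hK, fun p hp v g hv hg =>
      hN.gagliardo_le_of_testFunction hΩ_open hp (h p hp) hv hg⟩
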